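/- Let $A$ be an irreducible $k\times k$ matrix with entries in $\mathbb Z_{\ge 0}$, let $(X_A,\sigma_A)$ be the associated two-sided edge shift of finite type, and assume that it has positive topological entropy. Let $\mathrm{Aut}(\sigma_A)$ be the group of homeomorphisms of $X_A$ commuting with $\sigma_A$. *Range distortion.* For $\phi\in\mathrm{Aut}(\sigma_A)$ and $S,T\subset\mathbb Z$ say that $S$ $\phi$-codes $T$ if $x|_S=y|_S$ implies $\phi(x)|_T=\phi(y)|_T$ for all $x,y\in X_A$. Put $$W^-(n,\phi)=\sup\{m\in\mathbb Z : (-\infty,0]\ \phi^n\text{-codes}\ (-\infty,m]\},\qquad W^+(n,\phi)=\inf\{m\in\mathbb Z : [0,\infty)\ \phi^n\text{-codes}\ [m,\infty)\},$$ $$\alpha^\pm(\phi)=\lim_{n\to\infty}\frac{W^\pm(n,\phi)}{n}.$$ The automorphism $\phi$ is called range distorted if $\alpha^-(\phi)=\alpha^+(\phi)=0$. *Dimension representation.* With matrices acting on row vectors, let $R(A)=\mathbb Q^kA^k$, $$\mathcal G_A=\{x\in R(A): xA^n\in\mathbb Z^k\text{ for some }n\ge 0\},\quad \mathcal G_A^+=\{x\in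 R(A): xA^n\in\mathbb Z_{\ge0}^k\text{ for some }n\ge 0\},\quad \delta_A(x)=xA.$$ An $m$-ray is a set $R(x,m)=\{y\in X_A: y_i=x_i\text{ for all } i\le m\}$ with $x\in X_A$, and an $m$-beam is a finite union of $m$-rays. For an $m$-beam $U$ let $v_{U,m}\in\mathbb Z^k$ be the vector whose $J$-th entry is the number of distinct $m$-rays $R(x,m)$ in $U$ whose edge $x_m$ ends at the vertex $J$. Beams $U,V$ are equivalent if for some $m$ both are $m$-beams and $v_{U,m}=v_{V,m}$; write $[U]$ for the class of $U$. Let $D_A^+$ be the semigroup of classes of beams, with $[U]+[V]=[U\cup V]$ whenever $U\cap V=\emptyset$, let $D_A$ be its group completion, and let $\theta\colon D_A\to\mathcal G_A$ be the isomorphism induced by $\theta([U])=\delta_A^{-k-n}(v_{U,n}A^k)$ for an $n$-beam $U$. For $\phi\in\mathrm{Aut}(\sigma_A)$ let $\phi_*\colon D_A\to D_A$ be induced by $[U]\mapsto[\phi(U)]$. The dimension representation is $$\pi_A\colon\mathrm{Aut}(\sigma_A)\to\mathrm{Aut}(\mathcal G_A,\mathcal G_A^+,\delta_A),\qquad \pi_A(\phi)=S_\phi=\theta\circ\phi_*\circ\theta^{-1}.$$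 **Theorem.** Let $\phi\in\mathrm{Aut}(\sigma_A)$. If both $\phi$ and $\phi^{-1}$ are range distorted, then every eigenvalue of $\pi_A(\phi)=S_\phi$, that is, of the complex linear map $S_\phi\otimes 1\colon\mathcal G_A\otimes_{\mathbb Z}\mathbb C\to\mathcal G_A\otimes_{\mathbb Z}\mathbb C$, lies on the unit circle $\{\mu\in\mathbb C:|\mu|=1\}$. -/

import Mathlib

/-!
# Edge shifts, the dimension triple, the dimension representation, range distortion

`A` is always a `k × k` matrix over the nonnegative integers; matrices act on row vectors.
-/

noncomputable section

namespace EdgeShift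

variable {k : ℕ}

/-! ## The edge shift `(X_A, σ_A)` -/

/-- The edges of the directed graph with vertex set `Fin k` and `A i j` edges from `i` to `j`. -/
@[ext] structure Edge (A : Matrix (Fin k) (Fin k) ℕ) where
  src : Fin k
  tgt : Fin k
  lbl : Fin (A src tgt)

/-- The finite alphabet of edges is discrete. -/
instance (A : Matrix (Fin k) (Fin k) ℕ) : UniformSpace (Edge A) := ⊥

instance (A : Matrix (Fin k) (Fin k) ℕ) : DiscreteTopology (Edge A) := ⟨rfl⟩

instance (A : Matrix (Fin k) (Fin k) ℕ) : Finite (Edge A) :=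
  haveI : ∀ i j, Finite (Fin (A i j)) := fun i j => Finite.of_fintype _
  Finite.of_injective (β := Σ i : Fin k, Σ j : Fin k, Fin (A i j))
    (fun e => ⟨e.src, e.tgt, e.lbl⟩) (by
      rintro ⟨a, b, c⟩ ⟨a', b', c'⟩ h
      simp only [Sigma.mk.injEq] at h
      obtain ⟨rfl, h⟩ := h
      have h := eq_of_heq h
      simp only [Sigma.mk.injEq] at h
      obtain ⟨rfl, h⟩ := h
      cases h
      rfl)

/-- The space `X_A` of bi-infinite paths, with the topology (and uniformity) induced from the
product `(Edge A) ^ ℤ`. -/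
abbrev X (A : Matrix (Fin k) (Fin k) ℕ) : Type :=
  {x : ℤ → Edge A // ∀ i, (x i).tgt = (x (i + 1)).src}

/-- The shift map `σ_A`, `(σ x) i = x (i + 1)`. -/
def shift (A : Matrix (Fin k) (Fin k) ℕ) : X A ≃ₜ X A where
  toFun x := ⟨fun i => x.1 (i + 1), fun i => x.2 (i + 1)⟩
  invFun x := ⟨fun i => x.1 (i - 1), fun i => by
    have h := x.2 (i - 1)
    rwa [show i - 1 + 1 = i + 1 - 1 by ring] at h⟩
  left_inv x := by ext1; funext i; simp
  right_inv x := by ext1; funext i; simp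
  continuous_toFun := by
    refine Continuous.subtype_mk (continuous_pi fun i => ?_) _
    exact (continuous_apply (i + 1)).comp continuous_subtype_val
  continuous_invFun := by
    refine Continuous.subtype_mk (continuous_pi fun i => ?_) _
    exact (continuous_apply (i - 1)).comp continuous_subtype_val

/-- The automorphism group of `(X_A, σ_A)`: the homeomorphisms of `X_A` that commute with `σ_A`. -/
abbrev ShiftAut (A : Matrix (Fin k) (Fin k) ℕ) : Subgroup (X A ≃ₜ X A) :=
  Subgroup.centralizer {shift A}

/-- The standing assumptions: `A` is irreducible and the topological entropy of `(X_A, σ_A)` is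
positive. -/
class IrredPosEntropy (A : Matrix (Fin k) (Fin k) ℕ) : Prop where
  irreducible : (A.map (Nat.cast : ℕ → ℤ)).IsIrreducible
  entropy_pos : 0 < Dynamics.coverEntropy (shift A) Set.univ

variable {A : Matrix (Fin k) (Fin k) ℕ}

/-! ## Range distortion -/

/-- `S` `φ`-codes `T`: the coordinates of `x` in `S` determine the coordinates of `φ x` in `T`. -/
def Codes (φ : X A → X A) (S T : Set ℤ) : Prop :=
  ∀ x y : X A, (∀ i ∈ S, x.1 i = y.1 i) → ∀ j ∈ T, (φ x).1 j = (φ y).1 j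

/-- `C⁻(φ)`: the set of `m` such that `(-∞, 0]` `φ`-codes `(-∞, m]`. -/
def CMinus (φ : X A → X A) : Set ℤ := {m | Codes φ (Set.Iic 0) (Set.Iic m)}

/-- `C⁺(φ)`: the set of `m` such that `[0, ∞)` `φ`-codes `[m, ∞)`. -/
def CPlus (φ : X A → X A) : Set ℤ := {m | Codes φ (Set.Ici 0) (Set.Ici m)}

/-- `W⁻(n, φ) = sup C⁻(φⁿ)`, as an extended real number. -/
def WMinus (n : ℕ) (φ : ShiftAut A) : EReal :=
  sSup ((fun m : ℤ => ((m : ℝ) : EReal)) '' CMinus ⇑(φ ^ n : ShiftAut A).1)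

/-- `W⁺(n, φ) = inf C⁺(φⁿ)`, as an extended real number. -/
def WPlus (n : ℕ) (φ : ShiftAut A) : EReal :=
  sInf ((fun m : ℤ => ((m : ℝ) : EReal)) '' CPlus ⇑(φ ^ n : ShiftAut A).1)

/-- The Lyapunov exponent `α⁻(φ) = lim W⁻(n, φ) / n` exists and equals `a`. -/
def HasLyapunovMinus (φ : ShiftAut A) (a : EReal) : Prop :=
  Filter.Tendsto (fun n : ℕ => WMinus n φ / (n : EReal)) Filter.atTop (nhds a)

/-- The Lyapunov exponent `α⁺(φ) = lim W⁺(n, φ) / n` exists and equals `a`. -/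
def HasLyapunovPlus (φ : ShiftAut A) (a : EReal) : Prop :=
  Filter.Tendsto (fun n : ℕ => WPlus n φ / (n : EReal)) Filter.atTop (nhds a)

/-- `φ` is range distorted: `α⁻(φ) = α⁺(φ) = 0`. -/
def RangeDistorted (φ : ShiftAut A) : Prop :=
  HasLyapunovMinus φ 0 ∧ HasLyapunovPlus φ 0

/-! ## The dimension triple `(G_A, G_A⁺, δ_A)` -/

/-- `A` as a rational matrix. -/
abbrev ratMat (A : Matrix (Fin k) (Fin k) ℕ) : Matrix (Fin k) (Fin k) ℚ := A.map Nat.cast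

open scoped Matrix

/-- The eventual range `R(A) = ℚᵏ Aᵏ`. -/
def eventualRange (A : Matrix (Fin k) (Fin k) ℕ) : Submodule ℚ (Fin k → ℚ) :=
  LinearMap.range (Matrix.vecMulLinear (ratMat A ^ k))

theorem cast_vecMul_pow (u : Fin k → ℤ) (p : ℕ) : (fun i => (u i : ℚ)) ᵥ* ratMat A ^ p =
    fun i => (((u ᵥ* (A.map (Nat.cast : ℕ → ℤ)) ^ p) i : ℤ) : ℚ) := by
  have h := RingHom.map_vecMul (Int.castRingHom ℚ) ((A.map (Nat.cast : ℕ → ℤ)) ^ p) u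
  have h2 : ((A.map (Nat.cast : ℕ → ℤ)) ^ p).map (Int.castRingHom ℚ) = ratMat A ^ p := by
    rw [Matrix.map_pow]
    rfl
  funext i
  rw [← h2]
  exact (h i).symm

/-- `G_A = {x ∈ R(A) | x Aⁿ ∈ ℤᵏ for some n ≥ 0}`. -/
def dimSubgroup (A : Matrix (Fin k) (Fin k) ℕ) : AddSubgroup (Fin k → ℚ) where
  carrier := {x | x ∈ eventualRange A ∧
    ∃ n : ℕ, ∃ z : Fin k → ℤ, x ᵥ* ratMat A ^ n = fun i => (z i : ℚ)}
  zero_mem' := ⟨Submodule.zero_mem _, 0, 0, by ext; simp⟩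
  add_mem' := by
    rintro x y ⟨hx, n, z, hz⟩ ⟨hy, m, w, hw⟩
    refine ⟨Submodule.add_mem _ hx hy, n + m,
      z ᵥ* (A.map (Nat.cast : ℕ → ℤ)) ^ m + w ᵥ* (A.map (Nat.cast : ℕ → ℤ)) ^ n, ?_⟩
    rw [Matrix.add_vecMul]
    nth_rewrite 2 [add_comm n m]
    rw [pow_add, pow_add, ← Matrix.vecMul_vecMul, ← Matrix.vecMul_vecMul, hz, hw, cast_vecMul_pow,
      cast_vecMul_pow]
    ext i
    simp
  neg_mem' := by
    rintro x ⟨hx, n, z, hz⟩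
    exact ⟨Submodule.neg_mem _ hx, n, -z, by rw [Matrix.neg_vecMul, hz]; ext; simp⟩

/-- The dimension group `G_A`. -/
abbrev DimGroup (A : Matrix (Fin k) (Fin k) ℕ) : Type := dimSubgroup A

/-- The positive cone `G_A⁺ = {x ∈ R(A) | x Aⁿ ∈ (ℤ₊)ᵏ for some n ≥ 0}`. -/
def dimPos (A : Matrix (Fin k) (Fin k) ℕ) : Set (DimGroup A) :=
  {x | ∃ n : ℕ, ∃ z : Fin k → ℕ, (x : Fin k → ℚ) ᵥ* ratMat A ^ n = fun i => (z i : ℚ)}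

theorem vecMulLinear_pow (n : ℕ) :
    (Matrix.vecMulLinear (ratMat A) : Module.End ℚ (Fin k → ℚ)) ^ n
      = Matrix.vecMulLinear (ratMat A ^ n) := by
  induction n with
  | zero => ext; simp
  | succ n ih =>
    rw [pow_succ', ih]
    apply LinearMap.ext
    intro x
    rw [Module.End.mul_apply, Matrix.vecMulLinear_apply, Matrix.vecMulLinear_apply,
      Matrix.vecMulLinear_apply, Matrix.vecMul_vecMul, pow_succ]

theorem vecMul_eq_zero_of_succ {x : Fin k → ℚ} {n : ℕ} (h : x ᵥ* ratMat A ^ n = 0) :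
    x ᵥ* ratMat A ^ k = 0 := by
  have h1 := Module.End.ker_pow_le_ker_pow_finrank
    (Matrix.vecMulLinear (ratMat A) : Module.End ℚ (Fin k → ℚ)) n
  rw [Module.finrank_fin_fun, vecMulLinear_pow, vecMulLinear_pow] at h1
  exact h1 (show x ∈ LinearMap.ker _ from h)

theorem eventualRange_vecMul {x : Fin k → ℚ} (hx : x ∈ eventualRange A) :
    x ᵥ* ratMat A ∈ eventualRange A := by
  obtain ⟨y, rfl⟩ := hx
  refine ⟨y ᵥ* ratMat A, ?_⟩
  simp only [Matrix.vecMulLinear_apply, Matrix.vecMul_vecMul]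
  rw [← pow_succ, ← pow_succ']

theorem eventualRange_inj {x : Fin k → ℚ} (hx : x ∈ eventualRange A) (h : x ᵥ* ratMat A = 0) :
    x = 0 := by
  obtain ⟨y, rfl⟩ := hx
  simp only [Matrix.vecMulLinear_apply, Matrix.vecMul_vecMul] at h ⊢
  rw [← pow_succ] at h
  exact vecMul_eq_zero_of_succ h

theorem eventualRange_surj {x : Fin k → ℚ} (hx : x ∈ eventualRange A) :
    ∃ y ∈ eventualRange A, y ᵥ* ratMat A = x := by
  let T : eventualRange A →ₗ[ℚ] eventualRange A :=
    (Matrix.vecMulLinear (ratMat A)).restrict fun x hx => eventualRange_vecMul hx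
  have hT : Function.Injective T := by
    rw [injective_iff_map_eq_zero]
    intro a ha
    have := eventualRange_inj a.2 (congrArg Subtype.val ha)
    exact Subtype.ext this
  obtain ⟨y, hy⟩ := LinearMap.injective_iff_surjective.1 hT ⟨x, hx⟩
  exact ⟨y, y.2, congrArg Subtype.val hy⟩

/-- The map `x ↦ x A` as an endomorphism of `G_A`. -/
def deltaHom (A : Matrix (Fin k) (Fin k) ℕ) : DimGroup A →+ DimGroup A where
  toFun x := ⟨x.1 ᵥ* ratMat A, eventualRange_vecMul x.2.1, by
    obtain ⟨n, z, hz⟩ := x.2.2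
    refine ⟨n, z ᵥ* (A.map (Nat.cast : ℕ → ℤ)), ?_⟩
    have h := cast_vecMul_pow (A := A) z 1
    rw [pow_one, pow_one] at h
    rw [← h, ← hz, Matrix.vecMul_vecMul, Matrix.vecMul_vecMul, ← pow_succ, ← pow_succ']⟩
  map_zero' := by
    apply Subtype.ext
    change ((0 : DimGroup A) : Fin k → ℚ) ᵥ* ratMat A = ((0 : DimGroup A) : Fin k → ℚ)
    simp
  map_add' x y := by
    apply Subtype.ext
    change ((x + y : DimGroup A) : Fin k → ℚ) ᵥ* ratMat A = x.1 ᵥ* ratMat A + y.1 ᵥ* ratMat A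
    simp [Matrix.add_vecMul]

/-- The automorphism `δ_A(x) = x A` of `G_A`. -/
def delta (A : Matrix (Fin k) (Fin k) ℕ) : DimGroup A ≃ₗ[ℤ] DimGroup A :=
  LinearEquiv.ofBijective (deltaHom A).toIntLinearMap
    (by
      constructor
      · rw [injective_iff_map_eq_zero]
        intro a ha
        exact Subtype.ext (eventualRange_inj a.2.1 (congrArg Subtype.val ha))
      · intro x
        obtain ⟨y, hy, hyx⟩ := eventualRange_surj x.2.1
        obtain ⟨n, z, hz⟩ := x.2.2
        refine ⟨⟨y, hy, n + 1, z, ?_⟩, Subtype.ext hyx⟩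
        rw [pow_succ', ← Matrix.vecMul_vecMul, hyx, hz])

theorem delta_coe (x : DimGroup A) : (delta A x : Fin k → ℚ) = x.1 ᵥ* ratMat A := rfl

theorem delta_pow_coe (n : ℕ) (x : DimGroup A) :
    (((delta A) ^ n) x : Fin k → ℚ) = x.1 ᵥ* ratMat A ^ n := by
  induction n with
  | zero => simp
  | succ n ih =>
    rw [pow_succ', LinearEquiv.mul_apply, delta_coe, ih, Matrix.vecMul_vecMul, pow_succ]

/-- The group `Aut(G_A, G_A⁺, δ_A)`: the group automorphisms of `G_A` that map `G_A⁺` onto `G_A⁺`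
and commute with `δ_A`. -/
def DimAut (A : Matrix (Fin k) (Fin k) ℕ) : Subgroup (DimGroup A ≃ₗ[ℤ] DimGroup A) where
  carrier := {Φ | Φ '' dimPos A = dimPos A ∧ Φ * delta A = delta A * Φ}
  one_mem' := ⟨by simp, by simp⟩
  mul_mem' := by
    rintro Φ Ψ ⟨h1, h2⟩ ⟨h3, h4⟩
    refine ⟨?_, ?_⟩
    · rw [show (⇑(Φ * Ψ)) = Φ ∘ Ψ from rfl, Set.image_comp, h3, h1]
    · rw [mul_assoc, h4, ← mul_assoc, h2, mul_assoc]
  inv_mem' := by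
    rintro Φ ⟨h1, h2⟩
    refine ⟨?_, (Commute.inv_left (show Commute Φ (delta A) from h2)).eq⟩
    conv_lhs => rw [← h1]
    rw [← Set.image_comp]
    have : (⇑Φ⁻¹ ∘ ⇑Φ) = id := by
      funext x
      exact Φ.symm_apply_apply x
    rw [this, Set.image_id]

/-- For an integer row vector `v`, the element `v Aᵏ` of `G_A`. -/
def ofVec (A : Matrix (Fin k) (Fin k) ℕ) : (Fin k → ℤ) →+ DimGroup A where
  toFun v := ⟨(fun i => (v i : ℚ)) ᵥ* ratMat A ^ k, ⟨_, rfl⟩, 0,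
    v ᵥ* (A.map (Nat.cast : ℕ → ℤ)) ^ k, by rw [pow_zero, Matrix.vecMul_one, cast_vecMul_pow]⟩
  map_zero' := by
    ext1
    change (fun i => (((0 : Fin k → ℤ) i : ℤ) : ℚ)) ᵥ* ratMat A ^ k = 0
    rw [show (fun i => (((0 : Fin k → ℤ) i : ℤ) : ℚ)) = 0 by ext; simp, Matrix.zero_vecMul]
  map_add' v w := by
    ext1
    change (fun i => (((v + w) i : ℤ) : ℚ)) ᵥ* ratMat A ^ k
      = (fun i => (v i : ℚ)) ᵥ* ratMat A ^ k + (fun i => (w i : ℚ)) ᵥ* ratMat A ^ k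
    rw [← Matrix.add_vecMul]
    congr 1
    ext i
    simp

/-! ## Rays and beams -/

/-- The `m`-ray `R(x, m)`: the points that agree with `x` on `(-∞, m]`. -/
def ray (x : X A) (m : ℤ) : Set (X A) := {y | ∀ i ≤ m, y.1 i = x.1 i}

/-- An `m`-beam is a finite union of `m`-rays. -/
def IsBeam (m : ℤ) (U : Set (X A)) : Prop :=
  ∃ s : Set (X A), s.Finite ∧ U = ⋃ x ∈ s, ray x m

/-- The distinct `m`-rays `R(x, m)` with `x ∈ U` for which the edge `x m` ends at the vertex `J`. -/
def raysIn (U : Set (X A)) (m : ℤ) (J : Fin k) : Set (Set (X A)) :=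
  (fun x => ray x m) '' {x | x ∈ U ∧ (x.1 m).tgt = J}

/-- The vector `v_{U,m}` of an `m`-beam `U`: its `J`-th component is the number of distinct `m`-rays
making up `U` whose `m`-th edge ends at `J`. -/
def beamVec (U : Set (X A)) (m : ℤ) : Fin k → ℕ := fun J => (raysIn U m J).ncard

/-- Beams `U`, `V` are equivalent if both are `m`-beams and `v_{U,m} = v_{V,m}` for some `m`. -/
def BeamEquiv (U V : Set (X A)) : Prop :=
  ∃ m : ℤ, IsBeam m U ∧ IsBeam m V ∧ beamVec U m = beamVec V m

theorem mem_ray {x y : X A} {m : ℤ} : y ∈ ray x m ↔ ∀ i ≤ m, y.1 i = x.1 i := Iff.rfl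

theorem self_mem_ray (x : X A) (m : ℤ) : x ∈ ray x m := fun _ _ => rfl

theorem ray_eq_iff {x y : X A} {m : ℤ} : ray x m = ray y m ↔ ∀ i ≤ m, x.1 i = y.1 i := by
  constructor
  · intro h
    have : x ∈ ray y m := h ▸ self_mem_ray x m
    exact this
  · intro h
    ext z
    constructor
    · intro hz i hi
      rw [hz i hi, h i hi]
    · intro hz i hi
      rw [hz i hi, h i hi]

theorem image_finite_and_ncard_le {α β γ : Type*} {f : α → β} {g : α → γ} {S : Set α}
    (hg : (g '' S).Finite) (h : ∀ x ∈ S, ∀ y ∈ S, g x = g y → f x = f y) :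
    (f '' S).Finite ∧ (f '' S).ncard ≤ (g '' S).ncard := by
  obtain ⟨s, hs, hb⟩ := Set.exists_subset_bijOn S g
  have hsf : s.Finite := Set.Finite.of_finite_image (hb.image_eq.symm ▸ hg) hb.injOn
  have e : f '' S = f '' s := by
    apply Set.Subset.antisymm
    · rintro _ ⟨x, hx, rfl⟩
      obtain ⟨y, hy, hxy⟩ := hb.surjOn ⟨x, hx, rfl⟩
      exact ⟨y, hy, h y (hs hy) x hx hxy⟩
    · exact Set.image_mono hs
  rw [e, ← hb.image_eq, hb.injOn.ncard_image]
  exact ⟨hsf.image f, Set.ncard_image_le hsf⟩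

theorem isBeam_iff {m : ℤ} {U : Set (X A)} :
    IsBeam m U ↔ (∀ x ∈ U, ray x m ⊆ U) ∧ ((fun x => ray x m) '' U).Finite := by
  constructor
  · rintro ⟨s, hs, rfl⟩
    have key : ∀ x ∈ ⋃ x ∈ s, ray x m, ∃ y ∈ s, ray x m = ray y m := by
      intro x hx
      simp only [Set.mem_iUnion] at hx
      obtain ⟨y, hy, hxy⟩ := hx
      exact ⟨y, hy, ray_eq_iff.2 hxy⟩
    constructor
    · intro x hx
      obtain ⟨y, hy, h⟩ := key x hx
      rw [h]
      exact Set.subset_biUnion_of_mem (u := fun x => ray x m) hy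
    · refine (hs.image fun x => ray x m).subset ?_
      rintro _ ⟨x, hx, rfl⟩
      obtain ⟨y, hy, h⟩ := key x hx
      exact ⟨y, hy, h.symm⟩
  · rintro ⟨h1, h2⟩
    obtain ⟨s, hs, hb⟩ := Set.exists_subset_bijOn U fun x => ray x m
    refine ⟨s, Set.Finite.of_finite_image (hb.image_eq.symm ▸ h2) hb.injOn, ?_⟩
    apply Set.Subset.antisymm
    · intro x hx
      obtain ⟨y, hy, hxy⟩ := hb.surjOn ⟨x, hx, rfl⟩
      refine Set.mem_biUnion hy ?_
      have hxy : ray y m = ray x m := hxy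
      rw [hxy]
      exact self_mem_ray x m
    · exact Set.iUnion₂_subset fun y hy => h1 y (hs hy)

theorem IsBeam.finite_raysIn {m : ℤ} {U : Set (X A)} (h : IsBeam m U) (J : Fin k) :
    (raysIn U m J).Finite :=
  (isBeam_iff.1 h).2.subset (Set.image_mono fun _ hx => hx.1)

theorem IsBeam.union {m : ℤ} {U V : Set (X A)} (hU : IsBeam m U) (hV : IsBeam m V) :
    IsBeam m (U ∪ V) := by
  obtain ⟨s, hs, rfl⟩ := hU
  obtain ⟨t, ht, rfl⟩ := hV
  exact ⟨s ∪ t, hs.union ht, by rw [Set.biUnion_union]⟩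

theorem isBeam_empty (m : ℤ) : IsBeam m (∅ : Set (X A)) := ⟨∅, Set.finite_empty, by simp⟩

theorem beamVec_empty (m : ℤ) : beamVec (∅ : Set (X A)) m = 0 := by
  funext J
  simp [beamVec, raysIn]

theorem ray_succ_iff (x y : X A) (m : ℤ) :
    ((ray x m, x.1 (m + 1)) = (ray y m, y.1 (m + 1))) ↔ ray x (m + 1) = ray y (m + 1) := by
  simp only [Prod.mk.injEq, ray_eq_iff]
  constructor
  · rintro ⟨h1, h2⟩ i hi
    rcases hi.lt_or_eq with h | rfl
    · exact h1 i (by omega)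
    · exact h2
  · intro h
    exact ⟨fun i hi => h i (by omega), h _ le_rfl⟩

theorem IsBeam.succ {m : ℤ} {U : Set (X A)} (h : IsBeam m U) : IsBeam (m + 1) U := by
  rw [isBeam_iff] at h ⊢
  obtain ⟨h1, h2⟩ := h
  constructor
  · intro x hx y hy
    exact h1 x hx fun i hi => hy i (by omega)
  · have hfin : ((fun x : X A => (ray x m, x.1 (m + 1))) '' U).Finite :=
      (h2.prod (Set.finite_univ (α := Edge A))).subset (by
        rintro _ ⟨x, hx, rfl⟩
        exact ⟨⟨x, hx, rfl⟩, trivial⟩)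
    refine (image_finite_and_ncard_le hfin fun x _ y _ hxy => ?_).1
    exact (ray_succ_iff x y m).1 hxy

theorem IsBeam.mono {m n : ℤ} {U : Set (X A)} (h : IsBeam m U) (hmn : m ≤ n) : IsBeam n U := by
  induction n, hmn using Int.leInduction with
  | base => exact h
  | succ n _ ih => exact ih.succ

theorem beamVec_union {m : ℤ} {U V : Set (X A)} (hU : IsBeam m U) (hV : IsBeam m V)
    (hd : Disjoint U V) : beamVec (U ∪ V) m = beamVec U m + beamVec V m := by
  funext J
  have h1 : raysIn (U ∪ V) m J = raysIn U m J ∪ raysIn V m J := by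
    rw [raysIn, raysIn, raysIn, ← Set.image_union]
    congr 1
    ext x
    simp only [Set.mem_union, Set.mem_ofPred_eq]
    tauto
  have h2 : Disjoint (raysIn U m J) (raysIn V m J) := by
    rw [Set.disjoint_left]
    rintro _ ⟨x, ⟨hx, -⟩, rfl⟩ ⟨y, ⟨hy, -⟩, hxy⟩
    have : y ∈ U := (isBeam_iff.1 hU).1 x hx (by
      have hxy : ray y m = ray x m := hxy
      exact hxy ▸ self_mem_ray y m)
    exact Set.disjoint_left.1 hd this hy
  rw [beamVec, h1, Set.ncard_union_eq h2 (hU.finite_raysIn J) (hV.finite_raysIn J)]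
  rfl

/-- The path that follows `x` up to time `m` and `y` afterwards. -/
def glue (x y : X A) (m : ℤ) (h : (x.1 m).tgt = (y.1 m).tgt) : X A :=
  ⟨fun i => if i ≤ m then x.1 i else y.1 i, fun i => by
    beta_reduce
    rcases lt_trichotomy i m with hi | rfl | hi
    · rw [if_pos hi.le, if_pos (by omega)]
      exact x.2 i
    · rw [if_pos le_rfl, if_neg (by omega), h]
      exact y.2 i
    · rw [if_neg (by omega), if_neg (by omega)]
      exact y.2 i⟩

theorem glue_le {x y : X A} {m : ℤ} (h : (x.1 m).tgt = (y.1 m).tgt) {i : ℤ} (hi : i ≤ m) :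
    (glue x y m h).1 i = x.1 i := if_pos hi

theorem glue_gt {x y : X A} {m : ℤ} (h : (x.1 m).tgt = (y.1 m).tgt) {i : ℤ} (hi : m < i) :
    (glue x y m h).1 i = y.1 i := if_neg (by omega)

theorem exists_out [hA : IrredPosEntropy A] (i : Fin k) : ∃ e : Edge A, e.src = i := by
  obtain ⟨p, hp⟩ := hA.irreducible.connected i i
  let _ := Matrix.toQuiver (A.map (Nat.cast : ℕ → ℤ))
  obtain ⟨c, p₁, p₂, h, hl⟩ := Quiver.Path.exists_eq_comp_of_le_length p
    (n := 1) (Nat.succ_le_of_lt hp)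
  cases p₁ with
  | nil => simp at hl
  | cons q e =>
    have h0 := Quiver.Path.eq_of_length_zero q (by simpa using hl)
    subst h0
    have he := e.down
    simp only [Matrix.map_apply, Nat.cast_pos] at he
    exact ⟨⟨_, _, ⟨0, he⟩⟩, rfl⟩

theorem exists_in [hA : IrredPosEntropy A] (i : Fin k) : ∃ e : Edge A, e.tgt = i := by
  obtain ⟨p, hp⟩ := hA.irreducible.connected i i
  let _ := Matrix.toQuiver (A.map (Nat.cast : ℕ → ℤ))
  cases p with
  | nil => simp at hp
  | cons q e =>
    have he := e.down
    simp only [Matrix.map_apply, Nat.cast_pos] at he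
    exact ⟨⟨_, _, ⟨0, he⟩⟩, rfl⟩

theorem exists_point [hA : IrredPosEntropy A] (e : Edge A) (m : ℤ) : ∃ x : X A, x.1 m = e := by
  choose o ho using exists_out (A := A)
  choose n hn using exists_in (A := A)
  let r : ℕ → Edge A := fun j => Nat.rec e (fun _ f => o f.tgt) j
  let l : ℕ → Edge A := fun j => Nat.rec e (fun _ f => n f.src) j
  let s : ℤ → Edge A := fun i => if 0 ≤ i then r i.toNat else l (-i).toNat
  have hs : ∀ i, (s i).tgt = (s (i + 1)).src := by
    intro i
    by_cases hi : 0 ≤ i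
    · obtain ⟨j, rfl⟩ := Int.eq_ofNat_of_zero_le hi
      have e1 : s j = r j := by simp [s]
      have e2 : s ((j : ℤ) + 1) = r (j + 1) := by
        simp only [s]
        rw [if_pos (by omega)]
        congr 1
      rw [e1, e2]
      exact (ho _).symm
    · obtain ⟨j, hj⟩ := Int.eq_ofNat_of_zero_le (show 0 ≤ -i - 1 by omega)
      obtain rfl : i = -(j : ℤ) - 1 := by omega
      have e1 : s (-(j : ℤ) - 1) = l (j + 1) := by
        simp only [s]
        rw [if_neg hi, show (-(-(j : ℤ) - 1)).toNat = j + 1 by omega]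
      have e2 : s (-(j : ℤ) - 1 + 1) = l j := by
        rcases Nat.eq_zero_or_pos j with rfl | hj'
        · simp [s, r, l]
        · simp only [s]
          rw [if_neg (by omega), show (-(-(j : ℤ) - 1 + 1)).toNat = j by omega]
      rw [e1, e2]
      exact hn _
  refine ⟨⟨fun i => s (i - m), fun i => ?_⟩, ?_⟩
  · have := hs (i - m)
    rwa [show i - m + 1 = i + 1 - m by ring] at this
  · simp [s, r]

theorem ncard_edges (I J : Fin k) : {e : Edge A | e.src = I ∧ e.tgt = J}.ncard = A I J := by
  have : {e : Edge A | e.src = I ∧ e.tgt = J} =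
      Set.range (fun l : Fin (A I J) => (⟨I, J, l⟩ : Edge A)) := by
    ext ⟨a, b, c⟩
    constructor
    · rintro ⟨rfl, rfl⟩
      exact ⟨c, rfl⟩
    · rintro ⟨l, hl⟩
      cases hl
      exact ⟨rfl, rfl⟩
  rw [this, ← Set.image_univ, Set.InjOn.ncard_image, Set.ncard_univ, Nat.card_fin]
  intro a _ b _ h
  simpa using h

theorem beamVec_succ [hA : IrredPosEntropy A] {m : ℤ} {U : Set (X A)} (hU : IsBeam m U) :
    beamVec U (m + 1) = beamVec U m ᵥ* A := by
  funext J
  have hU' := isBeam_iff.1 hU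
  let f : X A → Set (X A) × Edge A := fun x => (ray x m, x.1 (m + 1))
  have hf : ∀ x y, f x = f y ↔ ray x (m + 1) = ray y (m + 1) := fun x y => ray_succ_iff x y m
  have e1 : (raysIn U (m + 1) J).ncard
      = (f '' {x | x ∈ U ∧ (x.1 (m + 1)).tgt = J}).ncard := by
    have h1 := image_finite_and_ncard_le (f := f) (hU.succ.finite_raysIn J)
      fun x _ y _ h => (hf x y).2 h
    exact le_antisymm (image_finite_and_ncard_le h1.1 fun x _ y _ h => (hf x y).1 h).2 h1.2
  have e2 : f '' {x | x ∈ U ∧ (x.1 (m + 1)).tgt = J}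
      = ⋃ I, (raysIn U m I) ×ˢ {e : Edge A | e.src = I ∧ e.tgt = J} := by
    ext ⟨R, e⟩
    simp only [Set.mem_image, Set.mem_ofPred_eq, Set.mem_iUnion, Set.mem_prod, f, Prod.mk.injEq]
    constructor
    · rintro ⟨x, ⟨hx, hJ⟩, rfl, rfl⟩
      exact ⟨(x.1 m).tgt, ⟨x, ⟨hx, rfl⟩, rfl⟩, (x.2 m).symm, hJ⟩
    · rintro ⟨I, ⟨x, ⟨hx, hI⟩, rfl⟩, he, hJ⟩
      obtain ⟨z, hz⟩ := exists_point e (m + 1)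
      have hxz : (x.1 m).tgt = (z.1 m).tgt := by rw [z.2 m, hz, he, hI]
      have hg : glue x z m hxz ∈ ray x m := fun i hi => glue_le hxz hi
      have hg2 : (glue x z m hxz).1 (m + 1) = e := by rw [glue_gt hxz (by omega), hz]
      refine ⟨glue x z m hxz, ⟨hU'.1 x hx hg, by rw [hg2, hJ]⟩, ?_, hg2⟩
      exact ray_eq_iff.2 hg
  rw [beamVec, e1, e2, Set.ncard_iUnion_of_finite, finsum_eq_sum_of_fintype]
  · simp only [Set.ncard_prod, ncard_edges, Matrix.vecMul, dotProduct, beamVec]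
  · intro I
    exact (hU.finite_raysIn I).prod (Set.toFinite _)
  · intro I I' hII
    rw [Function.onFun, Set.disjoint_left]
    rintro ⟨R, e⟩ ⟨-, h, -⟩ ⟨-, h', -⟩
    exact hII (h.symm.trans h')

theorem beamVec_add [hA : IrredPosEntropy A] {m : ℤ} {U : Set (X A)} (hU : IsBeam m U) (n : ℕ) :
    beamVec U (m + n) = beamVec U m ᵥ* A ^ n := by
  induction n with
  | zero => simp
  | succ n ih =>
    rw [Nat.cast_succ, ← add_assoc, beamVec_succ (hU.mono (by omega)), ih, Matrix.vecMul_vecMul,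
      pow_succ]

theorem BeamEquiv.at_ge [hA : IrredPosEntropy A] {m n : ℤ} {U V : Set (X A)} (hU : IsBeam m U)
    (hV : IsBeam m V) (h : beamVec U m = beamVec V m) (hmn : m ≤ n) :
    beamVec U n = beamVec V n := by
  obtain ⟨j, hj⟩ := Int.eq_ofNat_of_zero_le (show 0 ≤ n - m by omega)
  obtain rfl : n = m + j := by omega
  rw [beamVec_add hU, beamVec_add hV, h]

theorem infinite_X [hA : IrredPosEntropy A] : Infinite (X A) := by
  by_contra hfin
  rw [not_infinite_iff_finite] at hfin
  have hpos := hA.entropy_pos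
  refine absurd hpos (not_lt.2 ?_)
  rcases isEmpty_or_nonempty (X A) with he | hne
  · rw [Set.univ_eq_empty_iff.2 he, Dynamics.coverEntropy_empty]
    exact bot_le
  have := Fintype.ofFinite (X A)
  refine iSup₂_le fun U hU => ?_
  have hc : ((Fintype.card (X A) : ℕ∞) : ENNReal) ≠ 0 := by
    simp
  have hc' : ((Fintype.card (X A) : ℕ∞) : ENNReal) ≠ ⊤ := by simp
  rw [← ExpGrowth.expGrowthSup_const hc hc']
  refine ExpGrowth.expGrowthSup_monotone fun n => ?_
  refine ENat.toENNReal_mono ?_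
  refine Dynamics.IsDynCoverOf.coverMincard_le_card (s := (Finset.univ : Finset (X A))) ?_
  intro x _
  refine ⟨x, by simp, ?_⟩
  simp only [Dynamics.dynEntourage, Set.mem_iInter]
  intro i _
  rw [Set.mem_preimage]
  have : ∀ (i : ℕ) (p : X A × X A), p.1 = p.2 →
      ((Prod.map (shift A) (shift A))^[i] p).1 = ((Prod.map (shift A) (shift A))^[i] p).2 := by
    intro i
    induction i with
    | zero => exact fun p hp => hp
    | succ i ih => exact fun p hp => ih _ (congrArg (shift A) hp)
  have h := this i (x, x) rfl
  have h' := refl_mem_uniformity hU (x := ((Prod.map (shift A) (shift A))^[i] (x, x)).1)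
  nth_rewrite 2 [h] at h'
  exact h'

theorem shift_apply (x : X A) (i : ℤ) : (shift A x).1 i = x.1 (i + 1) := rfl

theorem shift_symm_apply (x : X A) (i : ℤ) : ((shift A).symm x).1 i = x.1 (i - 1) := rfl

theorem raysIn_finite_of_edge [hA : IrredPosEntropy A] {m : ℤ} (e : Edge A)
    (h : (raysIn (Set.univ : Set (X A)) m e.tgt).Finite) :
    (raysIn (Set.univ : Set (X A)) m e.src).Finite := by
  obtain ⟨z, hz⟩ := exists_point e (m + 1)
  have hg : ∀ x : X A, (x.1 m).tgt = e.src → (x.1 m).tgt = (z.1 m).tgt := by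
    intro x hx
    rw [z.2 m, hz, hx]
  classical
  let g : X A → X A := fun x =>
    if hx : (x.1 m).tgt = e.src then shift A (glue x z m (hg x hx)) else x
  have hgm : ∀ x : X A, ∀ hx : (x.1 m).tgt = e.src, g x = shift A (glue x z m (hg x hx)) :=
    fun x hx => dif_pos hx
  refine (image_finite_and_ncard_le (g := fun x => ray (g x) m) (h.subset ?_) ?_).1
  · rintro _ ⟨x, ⟨-, hx⟩, rfl⟩
    refine ⟨g x, ⟨trivial, ?_⟩, rfl⟩
    rw [hgm x hx, shift_apply, glue_gt _ (by omega), hz]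
  · rintro x ⟨-, hx⟩ y ⟨-, hy⟩ hxy
    simp only [ray_eq_iff] at hxy ⊢
    intro i hi
    have := hxy (i - 1) (by omega)
    rwa [hgm x hx, hgm y hy, shift_apply, shift_apply, sub_add_cancel, glue_le _ hi,
      glue_le _ hi] at this

theorem raysIn_infinite [hA : IrredPosEntropy A] (m : ℤ) (J : Fin k) :
    (raysIn (Set.univ : Set (X A)) m J).Infinite := by
  intro hJ
  have hall : ∀ I, (raysIn (Set.univ : Set (X A)) m I).Finite := by
    intro I
    let _ := Matrix.toQuiver (A.map (Nat.cast : ℕ → ℤ))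
    obtain ⟨p, -⟩ := hA.irreducible.connected I J
    induction p with
    | nil => exact hJ
    | cons q e ih =>
      apply ih
      have he := e.down
      simp only [Matrix.map_apply, Nat.cast_pos] at he
      exact raysIn_finite_of_edge (⟨_, _, ⟨0, he⟩⟩ : Edge A) hJ
  have hfin : (Set.range fun x : X A => ray x m).Finite := by
    refine (Set.finite_iUnion hall).subset ?_
    rintro _ ⟨x, rfl⟩
    exact Set.mem_iUnion.2 ⟨(x.1 m).tgt, x, ⟨trivial, rfl⟩, rfl⟩
  let st : Setoid (X A) := Setoid.ker fun x : X A => ray x m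
  have hst : ∀ x y : X A, st x y ↔ ∀ i ≤ m, x.1 i = y.1 i := fun x y => ray_eq_iff
  have hq : Finite (Quotient st) := by
    have := hfin.to_subtype
    exact Finite.of_equiv _ (Setoid.quotientKerEquivRange fun x : X A => ray x m).symm
  let G : Quotient st → Quotient st := Quotient.map ((shift A).symm) (by
    intro x y hxy
    have hxy := (hst x y).1 hxy
    refine (hst _ _).2 fun i hi => ?_
    exact hxy (i - 1) (by omega))
  have hsurj : Function.Surjective G := by
    intro q
    induction q using Quotient.inductionOn with
    | h y => exact ⟨⟦shift A y⟧, by simp [G]⟩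
  have hinj : Function.Injective G := Finite.injective_iff_surjective.2 hsurj
  have step : ∀ x y : X A, (∀ i ≤ m, x.1 i = y.1 i) →
      ∀ i ≤ m, (shift A x).1 i = (shift A y).1 i := by
    intro x y hxy
    have : G ⟦shift A x⟧ = G ⟦shift A y⟧ := by
      simp only [G, Quotient.map_mk, Homeomorph.symm_apply_apply]
      exact Quotient.sound ((hst _ _).2 hxy)
    exact (hst _ _).1 (Quotient.exact (hinj this))
  have hall : ∀ (n : ℕ) (x y : X A), (∀ i ≤ m, x.1 i = y.1 i) → ∀ i ≤ m + n, x.1 i = y.1 i := by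
    intro n
    induction n with
    | zero => intro x y h; simpa using h
    | succ n ih =>
      intro x y h i hi
      have := ih _ _ (step x y h) (i - 1) (by push_cast at hi; omega)
      simpa [shift_apply] using this
  have : Function.Injective fun x : X A => ray x m := by
    intro x y hxy
    have hxy := ray_eq_iff.1 hxy
    apply Subtype.ext
    funext i
    exact hall (i - m).toNat x y hxy i (by omega)
  have hX : Finite (X A) := by
    have hfin' := hfin.to_subtype
    exact Finite.of_injective (Set.rangeFactorization fun x : X A => ray x m)
      (Set.rangeFactorization_injective.2 this)
  exact infinite_X.not_finite hX

/-- Every vector of nonnegative integers is realized by an `m`-beam that avoids a given one. -/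
theorem exists_beam [hA : IrredPosEntropy A] {m : ℤ} {V : Set (X A)} (hV : IsBeam m V)
    (w : Fin k → ℕ) : ∃ U : Set (X A), IsBeam m U ∧ Disjoint U V ∧ beamVec U m = w := by
  have hVf := (isBeam_iff.1 hV).2
  have h : ∀ J, ∃ t ⊆ raysIn (Set.univ : Set (X A)) m J \ ((fun x => ray x m) '' V),
      t.Finite ∧ t.ncard = w J := fun J =>
    ((raysIn_infinite m J).sdiff hVf).exists_subset_ncard_eq (w J)
  choose t ht htf htc using h
  let U : Set (X A) := {x | ray x m ∈ t (x.1 m).tgt}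
  have hrays : ∀ J, raysIn U m J = t J := by
    intro J
    ext R
    constructor
    · rintro ⟨x, ⟨hx, rfl⟩, rfl⟩
      exact hx
    · intro hR
      obtain ⟨⟨x, ⟨-, hx⟩, rfl⟩, -⟩ := ht J hR
      exact ⟨x, ⟨by change ray x m ∈ t (x.1 m).tgt; rw [hx]; exact hR, hx⟩, rfl⟩
  refine ⟨U, isBeam_iff.2 ⟨?_, ?_⟩, ?_, ?_⟩
  · intro x hx y hy
    change ray y m ∈ t (y.1 m).tgt
    rw [hy m le_rfl, ray_eq_iff.2 hy]
    exact hx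
  · refine (Set.finite_iUnion htf).subset ?_
    rintro _ ⟨x, hx, rfl⟩
    exact Set.mem_iUnion.2 ⟨_, hx⟩
  · rw [Set.disjoint_left]
    intro x hx hxV
    exact (ht _ hx).2 ⟨x, hxV, rfl⟩
  · funext J
    rw [beamVec, hrays, htc]

theorem BeamEquiv.symm {U V : Set (X A)} (h : BeamEquiv U V) : BeamEquiv V U := by
  obtain ⟨m, hU, hV, h⟩ := h
  exact ⟨m, hV, hU, h.symm⟩

theorem BeamEquiv.trans [hA : IrredPosEntropy A] {U V W : Set (X A)} (h : BeamEquiv U V)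
    (h' : BeamEquiv V W) : BeamEquiv U W := by
  obtain ⟨m, hU, hV, h⟩ := h
  obtain ⟨n, hV', hW, h'⟩ := h'
  refine ⟨max m n, hU.mono (le_max_left _ _), hW.mono (le_max_right _ _), ?_⟩
  rw [BeamEquiv.at_ge hU hV h (le_max_left _ _), BeamEquiv.at_ge hV' hW h' (le_max_right _ _)]

/-! ## The action of an automorphism on beams -/

theorem ShiftAut.comm (φ : ShiftAut A) (x : X A) : φ.1 (shift A x) = shift A (φ.1 x) := by
  have := Subgroup.mem_centralizer_singleton_iff.1 φ.2
  exact congrArg (fun f : X A ≃ₜ X A => f x) this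

theorem ShiftAut.comm_pow (φ : ShiftAut A) (x : X A) (n : ℕ) :
    φ.1 ((shift A)^[n] x) = (shift A)^[n] (φ.1 x) := by
  induction n generalizing x with
  | zero => rfl
  | succ n ih => rw [Function.iterate_succ_apply, ih, ShiftAut.comm, Function.iterate_succ_apply]

theorem shift_iterate_apply (x : X A) (n : ℕ) (i : ℤ) :
    ((shift A)^[n] x).1 i = x.1 (i + n) := by
  induction n generalizing x with
  | zero => simp
  | succ n ih =>
    rw [Function.iterate_succ_apply, ih, shift_apply]
    rw [show i + ((n + 1 : ℕ) : ℤ) = i + n + 1 by push_cast; ring]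

instance : CompactSpace (X A) := by
  refine isCompact_iff_compactSpace.1 (IsClosed.isCompact ?_)
  have : {x : ℤ → Edge A | ∀ i, (x i).tgt = (x (i + 1)).src}
      = ⋂ i, {x | (x i).tgt = (x (i + 1)).src} := by
    ext x
    simp
  change IsClosed {x : ℤ → Edge A | ∀ i, (x i).tgt = (x (i + 1)).src}
  rw [this]
  refine isClosed_iInter fun i => ?_
  refine isClosed_eq ?_ ?_
  · exact (continuous_of_discreteTopology (f := fun e : Edge A => e.tgt)).comp (continuous_apply i)
  · exact (continuous_of_discreteTopology (f := fun e : Edge A => e.src)).comp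
      (continuous_apply (i + 1))

/-- An automorphism is given by a block code of finite range. -/
theorem ShiftAut.exists_range (φ : ShiftAut A) : ∃ r : ℕ, ∀ (x y : X A) (i : ℤ),
    (∀ j, i - r ≤ j → j ≤ i + r → x.1 j = y.1 j) → (φ.1 x).1 i = (φ.1 y).1 i := by
  have h0 : ∃ r : ℕ, ∀ (x y : X A),
      (∀ j : ℤ, -(r : ℤ) ≤ j → j ≤ r → x.1 j = y.1 j) → (φ.1 x).1 0 = (φ.1 y).1 0 := by
    by_contra! hcon
    have hco : ∀ j : ℤ, Continuous fun x : X A => x.1 j := fun j =>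
      (continuous_apply j).comp continuous_subtype_val
    let K : ℕ → Set (X A × X A) := fun r =>
      {p | (∀ j : ℤ, -(r : ℤ) ≤ j → j ≤ r → p.1.1 j = p.2.1 j) ∧
        (φ.1 p.1).1 0 ≠ (φ.1 p.2).1 0}
    have hcl : ∀ r, IsClosed (K r) := by
      intro r
      have e : K r = (⋂ j : ℤ, ⋂ (_ : -(r : ℤ) ≤ j), ⋂ (_ : j ≤ r),
          {p : X A × X A | p.1.1 j = p.2.1 j}) ∩
          {p : X A × X A | (φ.1 p.1).1 0 = (φ.1 p.2).1 0}ᶜ := by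
        ext p
        simp [K]
      rw [e]
      refine IsClosed.inter ?_ ?_
      · refine isClosed_iInter fun j => isClosed_iInter fun _ => isClosed_iInter fun _ => ?_
        exact isClosed_eq ((hco j).comp continuous_fst) ((hco j).comp continuous_snd)
      · rw [isClosed_compl_iff]
        have hc1 : Continuous fun p : X A × X A => ((φ.1 p.1).1 0, (φ.1 p.2).1 0) :=
          (((hco 0).comp φ.1.continuous).comp continuous_fst).prodMk
            (((hco 0).comp φ.1.continuous).comp continuous_snd)
        exact (isOpen_discrete {q : Edge A × Edge A | q.1 = q.2}).preimage hc1
    obtain ⟨p, hp⟩ := IsCompact.nonempty_iInter_of_sequence_nonempty_isCompact_isClosed K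
      (fun r p hp => ⟨fun j h1 h2 => hp.1 j (by push_cast; omega) (by push_cast; omega), hp.2⟩)
      (fun r => by
        obtain ⟨x, y, h1, h2⟩ := hcon r
        exact ⟨(x, y), h1, h2⟩)
      (hcl 0).isCompact hcl
    rw [Set.mem_iInter] at hp
    have : p.1 = p.2 := by
      apply Subtype.ext
      funext j
      exact (hp j.natAbs).1 j (by omega) (by omega)
    exact (hp 0).2 (by rw [this])
  obtain ⟨r, hr⟩ := h0
  refine ⟨r, fun x y i h => ?_⟩
  rcases le_total 0 i with hi | hi
  · obtain ⟨n, rfl⟩ := Int.eq_ofNat_of_zero_le hi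
    have := hr ((shift A)^[n] x) ((shift A)^[n] y) fun j h1 h2 => by
      rw [shift_iterate_apply, shift_iterate_apply]
      exact h _ (by omega) (by omega)
    rw [ShiftAut.comm_pow, ShiftAut.comm_pow, shift_iterate_apply, shift_iterate_apply] at this
    simpa using this
  · obtain ⟨n, hn⟩ := Int.eq_ofNat_of_zero_le (show 0 ≤ -i by omega)
    obtain rfl : i = -(n : ℤ) := by omega
    have hx : ∀ x : X A, ∃ x', (shift A)^[n] x' = x := fun x =>
      (shift A).surjective.iterate n x
    obtain ⟨x', rfl⟩ := hx x
    obtain ⟨y', rfl⟩ := hx y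
    have := hr x' y' fun j h1 h2 => by
      have := h (j - n) (by omega) (by omega)
      rw [shift_iterate_apply, shift_iterate_apply] at this
      simpa using this
    rw [ShiftAut.comm_pow, ShiftAut.comm_pow, shift_iterate_apply, shift_iterate_apply]
    simpa using this

/-- A common range for `φ` and `φ⁻¹`. -/
theorem ShiftAut.exists_range₂ (φ : ShiftAut A) : ∃ r : ℕ,
    (∀ (x y : X A) (i : ℤ),
      (∀ j, i - r ≤ j → j ≤ i + r → x.1 j = y.1 j) → (φ.1 x).1 i = (φ.1 y).1 i) ∧
    (∀ (x y : X A) (i : ℤ),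
      (∀ j, i - r ≤ j → j ≤ i + r → (φ.1 x).1 j = (φ.1 y).1 j) → x.1 i = y.1 i) := by
  obtain ⟨r, hr⟩ := ShiftAut.exists_range φ
  obtain ⟨s, hs⟩ := ShiftAut.exists_range φ⁻¹
  refine ⟨max r s, fun x y i h => hr x y i fun j h1 h2 => h j ?_ ?_, fun x y i h => ?_⟩
  · push_cast; omega
  · push_cast; omega
  · have := hs (φ.1 x) (φ.1 y) i fun j h1 h2 => h j (by push_cast; omega) (by push_cast; omega)
    have e : ∀ z : X A, (φ⁻¹).1 (φ.1 z) = z := fun z => φ.1.symm_apply_apply z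
    rwa [e, e] at this

theorem IsBeam.image_aux {φ : ShiftAut A} {r : ℕ}
    (h1 : ∀ (x y : X A) (i : ℤ),
      (∀ j, i - r ≤ j → j ≤ i + r → x.1 j = y.1 j) → (φ.1 x).1 i = (φ.1 y).1 i)
    (h2 : ∀ (x y : X A) (i : ℤ),
      (∀ j, i - r ≤ j → j ≤ i + r → (φ.1 x).1 j = (φ.1 y).1 j) → x.1 i = y.1 i)
    {m : ℤ} {U : Set (X A)} (hU : IsBeam m U) : IsBeam (m + r) (φ.1 '' U) := by
  have hU0 := isBeam_iff.1 hU
  have hU2 := isBeam_iff.1 (hU.mono (show m ≤ m + r + r by omega))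
  refine isBeam_iff.2 ⟨?_, ?_⟩
  · rintro _ ⟨x, hx, rfl⟩ y hy
    obtain ⟨z, rfl⟩ := φ.1.surjective y
    refine ⟨z, hU0.1 x hx fun i hi => ?_, rfl⟩
    exact h2 z x i fun j _ hj => hy j (by omega)
  · rw [Set.image_image]
    refine (image_finite_and_ncard_le hU2.2 fun x _ y _ hxy => ?_).1
    rw [ray_eq_iff] at hxy ⊢
    intro i hi
    exact h1 x y i fun j _ hj => hxy j (by omega)

theorem IsBeam.image (φ : ShiftAut A) {m : ℤ} {U : Set (X A)} (hU : IsBeam m U) :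
    ∃ n, IsBeam n (φ.1 '' U) := by
  obtain ⟨r, h1, h2⟩ := ShiftAut.exists_range₂ φ
  exact ⟨_, hU.image_aux h1 h2⟩

theorem beamVec_image_le {φ : ShiftAut A} {r : ℕ}
    (h1 : ∀ (x y : X A) (i : ℤ),
      (∀ j, i - r ≤ j → j ≤ i + r → x.1 j = y.1 j) → (φ.1 x).1 i = (φ.1 y).1 i)
    (h2 : ∀ (x y : X A) (i : ℤ),
      (∀ j, i - r ≤ j → j ≤ i + r → (φ.1 x).1 j = (φ.1 y).1 j) → x.1 i = y.1 i)
    {m : ℤ} {U V : Set (X A)} (hU : IsBeam m U) (hV : IsBeam m V)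
    (h : beamVec U m = beamVec V m) (J : Fin k) :
    beamVec (φ.1 '' U) (m + 3 * r + 1) J ≤ beamVec (φ.1 '' V) (m + 3 * r + 1) J := by
  classical
  have hV0 := isBeam_iff.1 hV
  -- an end-state preserving injection from the `m`-rays of `U` to those of `V`
  have hg : ∀ I, ∃ g : Set (X A) → Set (X A),
      Set.MapsTo g (raysIn U m I) (raysIn V m I) ∧ Set.InjOn g (raysIn U m I) := by
    intro I
    have hle : (raysIn U m I).encard ≤ (raysIn V m I).encard := by
      rw [← (hU.finite_raysIn I).cast_ncard_eq, ← (hV.finite_raysIn I).cast_ncard_eq]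
      exact le_of_eq (congrArg _ (congrFun h I))
    by_cases hne : Nonempty (Set (X A))
    · obtain ⟨g, hg1, hg2⟩ := (hU.finite_raysIn I).exists_injOn_of_encard_le hle
      exact ⟨g, hg1, hg2⟩
    · exact (hne ⟨∅⟩).elim
  choose g hg1 hg2 using hg
  have hrep : ∀ z ∈ U, ∃ y ∈ V, (y.1 m).tgt = (z.1 m).tgt ∧
      ray y m = g (z.1 m).tgt (ray z m) := by
    intro z hz
    obtain ⟨y, ⟨hy, hy'⟩, hyr⟩ := hg1 (z.1 m).tgt ⟨z, ⟨hz, rfl⟩, rfl⟩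
    exact ⟨y, hy, hy', hyr⟩
  choose! y hyV hyt hyr using hrep
  let f : X A → X A := fun z => if hz : z ∈ U then glue (y z) z m (hyt z hz) else z
  have hf : ∀ z, ∀ hz : z ∈ U, f z = glue (y z) z m (hyt z hz) := fun z hz => dif_pos hz
  have hfle : ∀ z ∈ U, ∀ i ≤ m, (f z).1 i = (y z).1 i := fun z hz i hi => by
    rw [hf z hz, glue_le _ hi]
  have hfgt : ∀ z ∈ U, ∀ i, m < i → (f z).1 i = z.1 i := fun z hz i hi => by
    rw [hf z hz, glue_gt _ hi]
  have hfV : ∀ z ∈ U, f z ∈ V := fun z hz => hV0.1 _ (hyV z hz) (hfle z hz)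
  have hφf : ∀ z ∈ U, ∀ i, m + r < i → (φ.1 (f z)).1 i = (φ.1 z).1 i := fun z hz i hi =>
    h1 _ _ _ fun j hj _ => hfgt z hz j (by omega)
  set n : ℤ := m + 3 * r + 1 with hn
  have hVn : IsBeam n (φ.1 '' V) := (hV.image_aux h1 h2).mono (by omega)
  have hsub : (fun z => ray (φ.1 (f z)) n) '' {z | z ∈ U ∧ ((φ.1 z).1 n).tgt = J}
      ⊆ raysIn (φ.1 '' V) n J := by
    rintro _ ⟨z, ⟨hz, hJ⟩, rfl⟩
    refine ⟨φ.1 (f z), ⟨⟨f z, hfV z hz, rfl⟩, ?_⟩, rfl⟩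
    rw [hφf z hz n (by omega), hJ]
  have e : raysIn (φ.1 '' U) n J
      = (fun z => ray (φ.1 z) n) '' {z | z ∈ U ∧ ((φ.1 z).1 n).tgt = J} := by
    ext R
    constructor
    · rintro ⟨_, ⟨⟨z, hz, rfl⟩, hJ⟩, rfl⟩
      exact ⟨z, ⟨hz, hJ⟩, rfl⟩
    · rintro ⟨z, ⟨hz, hJ⟩, rfl⟩
      exact ⟨φ.1 z, ⟨⟨z, hz, rfl⟩, hJ⟩, rfl⟩
  rw [beamVec, beamVec, e]
  refine le_trans (image_finite_and_ncard_le ((hVn.finite_raysIn J).subset hsub) ?_).2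
    (Set.ncard_le_ncard hsub (hVn.finite_raysIn J))
  rintro z ⟨hz, -⟩ w ⟨hw, -⟩ hzw
  have hzw : ∀ i ≤ n, (φ.1 (f z)).1 i = (φ.1 (f w)).1 i := ray_eq_iff.1 hzw
  have hff : ∀ i ≤ n - r, (f z).1 i = (f w).1 i := fun i hi =>
    h2 _ _ _ fun j _ hj => hzw j (by omega)
  have hyy : ray (y z) m = ray (y w) m := ray_eq_iff.2 fun i hi => by
    rw [← hfle z hz i hi, ← hfle w hw i hi, hff i (by omega)]
  have htt : (z.1 m).tgt = (w.1 m).tgt := by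
    rw [← hyt z hz, ← hyt w hw, ray_eq_iff.1 hyy m le_rfl]
  have hzwm : ray z m = ray w m := by
    rw [hyr z hz, hyr w hw, htt] at hyy
    exact hg2 _ ⟨z, ⟨hz, htt⟩, rfl⟩ ⟨w, ⟨hw, rfl⟩, rfl⟩ hyy
  have hzwn : ∀ i ≤ n - r, z.1 i = w.1 i := by
    intro i hi
    rcases le_or_gt i m with him | him
    · exact ray_eq_iff.1 hzwm i him
    · rw [← hfgt z hz i him, ← hfgt w hw i him, hff i hi]
  refine ray_eq_iff.2 fun i hi => ?_
  rcases le_or_gt i (n - r - r) with him | him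
  · exact h1 _ _ _ fun j _ hj => hzwn j (by omega)
  · rw [← hφf z hz i (by omega), ← hφf w hw i (by omega), hzw i hi]

theorem BeamEquiv.image (φ : ShiftAut A) {U V : Set (X A)} (h : BeamEquiv U V) :
    BeamEquiv (φ.1 '' U) (φ.1 '' V) := by
  obtain ⟨r, h1, h2⟩ := ShiftAut.exists_range₂ φ
  obtain ⟨m, hU, hV, h⟩ := h
  refine ⟨m + 3 * r + 1, (hU.image_aux h1 h2).mono (by omega),
    (hV.image_aux h1 h2).mono (by omega), ?_⟩
  funext J
  exact le_antisymm (beamVec_image_le h1 h2 hU hV h J) (beamVec_image_le h1 h2 hV hU h.symm J)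

/-! ## Krieger's dimension group `D_A` -/

/-- Beams, i.e. `m`-beams for some `m`. -/
def Beam (A : Matrix (Fin k) (Fin k) ℕ) : Type := {U : Set (X A) // ∃ m, IsBeam m U}

/-- Equivalence of beams. -/
instance beamSetoid (A : Matrix (Fin k) (Fin k) ℕ) [IrredPosEntropy A] : Setoid (Beam A) where
  r U V := BeamEquiv U.1 V.1
  iseqv :=
    ⟨fun U => by
      obtain ⟨m, h⟩ := U.2
      exact ⟨m, h, h, rfl⟩, BeamEquiv.symm, BeamEquiv.trans⟩

/-- The semigroup `D_A⁺` of equivalence classes `[U]` of beams. -/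
def DPlus (A : Matrix (Fin k) (Fin k) ℕ) [IrredPosEntropy A] : Type := Quotient (beamSetoid A)

/-- The equivalence class `[U]` of a beam `U`. -/
def beamClass [IrredPosEntropy A] (U : Beam A) : DPlus A := Quotient.mk (beamSetoid A) U

/-- The union of two beams. -/
def Beam.union (U V : Beam A) : Beam A :=
  ⟨U.1 ∪ V.1, by
    obtain ⟨m, hU⟩ := U.2
    obtain ⟨n, hV⟩ := V.2
    exact ⟨max m n, (hU.mono (le_max_left _ _)).union (hV.mono (le_max_right _ _))⟩⟩

theorem beamClass_eq_iff [IrredPosEntropy A] {U V : Beam A} :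
    beamClass U = beamClass V ↔ BeamEquiv U.1 V.1 := Quotient.eq (r := beamSetoid A)

theorem exists_disjoint_rep [IrredPosEntropy A] (a b : DPlus A) :
    ∃ U V : Beam A, beamClass U = a ∧ beamClass V = b ∧ Disjoint U.1 V.1 := by
  obtain ⟨U, rfl⟩ := Quotient.exists_rep a
  obtain ⟨V, rfl⟩ := Quotient.exists_rep b
  obtain ⟨m, hU⟩ := U.2
  obtain ⟨n, hV⟩ := V.2
  have hU' := hU.mono (le_max_left m n)
  have hV' := hV.mono (le_max_right m n)
  obtain ⟨W, hW, hd, hw⟩ := exists_beam hV' (beamVec U.1 (max m n))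
  exact ⟨⟨W, _, hW⟩, V, beamClass_eq_iff.2 ⟨_, hW, hU', hw⟩, rfl, hd⟩

/-- Addition: `[U] + [V] = [U' ∪ V']`, where `[U] = [U']`, `[V] = [V']` and `U' ∩ V' = ∅`. -/
instance [IrredPosEntropy A] : Add (DPlus A) where
  add a b := beamClass ((exists_disjoint_rep a b).choose.union
    (exists_disjoint_rep a b).choose_spec.choose)

/-- The zero of `D_A⁺` is the class of the empty beam. -/
instance [IrredPosEntropy A] : Zero (DPlus A) where
  zero := beamClass ⟨∅, 0, isBeam_empty 0⟩

theorem beamClass_add [IrredPosEntropy A] {U V : Beam A} (hd : Disjoint U.1 V.1) :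
    beamClass U + beamClass V = beamClass (U.union V) := by
  obtain ⟨h1, h2, h3⟩ := (exists_disjoint_rep (beamClass U) (beamClass V)).choose_spec.choose_spec
  change beamClass (Beam.union _ _) = _
  set U' := (exists_disjoint_rep (beamClass U) (beamClass V)).choose
  set V' := (exists_disjoint_rep (beamClass U) (beamClass V)).choose_spec.choose
  rw [beamClass_eq_iff] at h1 h2 ⊢
  obtain ⟨m, hU', hU, hm⟩ := h1
  obtain ⟨n, hV', hV, hn⟩ := h2
  have hl := le_max_left m n
  have hr := le_max_right m n
  refine ⟨max m n, (hU'.mono hl).union (hV'.mono hr), (hU.mono hl).union (hV.mono hr), ?_⟩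
  change beamVec (U'.1 ∪ V'.1) _ = beamVec (U.1 ∪ V.1) _
  rw [beamVec_union (hU'.mono hl) (hV'.mono hr) h3, beamVec_union (hU.mono hl) (hV.mono hr) hd,
    BeamEquiv.at_ge hU' hU hm hl, BeamEquiv.at_ge hV' hV hn hr]

/-- The vector `v_{U,m}` as an integer vector. -/
def intVec (U : Set (X A)) (m : ℤ) : Fin k → ℤ := fun J => (beamVec U m J : ℤ)

/-- `δ_A^{-k-n}(v_{U,n} Aᵏ)`. -/
def thetaAt (U : Set (X A)) (n : ℤ) : DimGroup A :=
  (delta A ^ (-(k : ℤ) - n)) (ofVec A (intVec U n))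

theorem intVec_succ [IrredPosEntropy A] {m : ℤ} {U : Set (X A)} (hU : IsBeam m U) :
    intVec U (m + 1) = intVec U m ᵥ* A.map (Nat.cast : ℕ → ℤ) := by
  funext J
  rw [intVec, beamVec_succ hU]
  simp [Matrix.vecMul, dotProduct, intVec]

theorem ofVec_coe (v : Fin k → ℤ) :
    (ofVec A v : Fin k → ℚ) = (fun i => (v i : ℚ)) ᵥ* ratMat A ^ k := rfl

theorem ofVec_vecMul (v : Fin k → ℤ) :
    ofVec A (v ᵥ* A.map (Nat.cast : ℕ → ℤ)) = delta A (ofVec A v) := by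
  apply Subtype.ext
  have h := cast_vecMul_pow (A := A) v 1
  rw [pow_one, pow_one] at h
  rw [delta_coe, ofVec_coe, ofVec_coe, ← h, Matrix.vecMul_vecMul, Matrix.vecMul_vecMul, ← pow_succ,
    ← pow_succ']

theorem thetaAt_succ [IrredPosEntropy A] {m : ℤ} {U : Set (X A)} (hU : IsBeam m U) :
    thetaAt U (m + 1) = thetaAt U m := by
  rw [thetaAt, intVec_succ hU, ofVec_vecMul, ← LinearEquiv.mul_apply, ← zpow_add_one, thetaAt]
  congr 2
  ring

theorem thetaAt_ge [IrredPosEntropy A] {m n : ℤ} {U : Set (X A)} (hU : IsBeam m U) (hmn : m ≤ n) :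
    thetaAt U n = thetaAt U m := by
  induction n, hmn using Int.leInduction with
  | base => rfl
  | succ n h ih => rw [thetaAt_succ (hU.mono h), ih]

theorem thetaAt_eq [IrredPosEntropy A] {m n : ℤ} {U : Set (X A)} (hU : IsBeam m U)
    (hU' : IsBeam n U) : thetaAt U m = thetaAt U n := by
  rw [← thetaAt_ge hU (le_max_left m n), ← thetaAt_ge hU' (le_max_right m n)]

/-- The underlying map of `θ : D_A⁺ → G_A`, `θ([U]) = δ_A^{-k-n}(v_{U,n} Aᵏ)` for an `n`-beam `U`. -/
def thetaFun [IrredPosEntropy A] : DPlus A → DimGroup A :=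
  Quotient.lift (fun U : Beam A => thetaAt U.1 U.2.choose) (by
    rintro U V ⟨m, hU, hV, h⟩
    have hv : intVec U.1 m = intVec V.1 m := by
      funext J
      simp only [intVec, h]
    rw [thetaAt_eq U.2.choose_spec hU, thetaAt_eq V.2.choose_spec hV, thetaAt, thetaAt, hv])

theorem thetaFun_beamClass [IrredPosEntropy A] (U : Beam A) {n : ℤ} (hU : IsBeam n U.1) :
    thetaFun (beamClass U) = thetaAt U.1 n := thetaAt_eq U.2.choose_spec hU

theorem thetaFun_injective [IrredPosEntropy A] : Function.Injective (thetaFun (A := A)) := by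
  intro a b hab
  obtain ⟨U, rfl⟩ := Quotient.exists_rep a
  obtain ⟨V, rfl⟩ := Quotient.exists_rep b
  change thetaFun (beamClass U) = thetaFun (beamClass V) at hab
  obtain ⟨m, hU⟩ := U.2
  obtain ⟨n, hV⟩ := V.2
  replace hU := hU.mono (le_max_left m n)
  replace hV := hV.mono (le_max_right m n)
  set p := max m n
  rw [thetaFun_beamClass U hU, thetaFun_beamClass V hV, thetaAt, thetaAt] at hab
  have h := congrArg Subtype.val ((delta A ^ (-(k : ℤ) - p)).injective hab)
  rw [ofVec_coe, ofVec_coe, cast_vecMul_pow, cast_vecMul_pow] at h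
  refine beamClass_eq_iff.2 ⟨p + k, hU.mono (by omega), hV.mono (by omega), ?_⟩
  rw [beamVec_add hU, beamVec_add hV]
  have key : ∀ W : Set (X A), ∀ i, ((intVec W p ᵥ* (A.map (Nat.cast : ℕ → ℤ)) ^ k) i)
      = (((beamVec W p ᵥ* A ^ k) i : ℕ) : ℤ) := by
    intro W i
    have h := RingHom.map_vecMul (Nat.castRingHom ℤ) (A ^ k) (beamVec W p) i
    have h2 : (A ^ k).map (Nat.castRingHom ℤ) = (A.map (Nat.cast : ℕ → ℤ)) ^ k := by
      rw [Matrix.map_pow]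
      rfl
    rw [h2] at h
    exact h.symm
  funext i
  have hi := congrFun h i
  rw [key, key] at hi
  exact_mod_cast hi

theorem thetaFun_add [IrredPosEntropy A] (a b : DPlus A) :
    thetaFun (a + b) = thetaFun a + thetaFun b := by
  obtain ⟨U, V, rfl, rfl, hd⟩ := exists_disjoint_rep a b
  obtain ⟨m, hU⟩ := U.2
  obtain ⟨n, hV⟩ := V.2
  replace hU := hU.mono (le_max_left m n)
  replace hV := hV.mono (le_max_right m n)
  rw [beamClass_add hd, thetaFun_beamClass (U.union V) (hU.union hV), thetaFun_beamClass U hU,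
    thetaFun_beamClass V hV, thetaAt, thetaAt, thetaAt, ← map_add, ← map_add]
  congr 2
  funext J
  simp only [Pi.add_apply, intVec]
  rw [show (U.union V).1 = U.1 ∪ V.1 from rfl, beamVec_union hU hV hd, Pi.add_apply, Nat.cast_add]

theorem thetaFun_zero [IrredPosEntropy A] : thetaFun (0 : DPlus A) = 0 := by
  have h := thetaFun_beamClass (A := A) ⟨∅, 0, isBeam_empty 0⟩ (isBeam_empty 0)
  refine h.trans ?_
  have h0 : intVec (∅ : Set (X A)) 0 = 0 := by
    funext J
    simp [intVec, beamVec_empty]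
  rw [thetaAt, h0, map_zero, map_zero]

/-- `D_A⁺` is a commutative monoid. -/
instance [IrredPosEntropy A] : AddCommMonoid (DPlus A) where
  add_assoc a b c := thetaFun_injective (by simp only [thetaFun_add, add_assoc])
  zero_add a := thetaFun_injective (by simp only [thetaFun_add, thetaFun_zero, zero_add])
  add_zero a := thetaFun_injective (by simp only [thetaFun_add, thetaFun_zero, add_zero])
  add_comm a b := thetaFun_injective (by simp only [thetaFun_add, add_comm])
  nsmul := nsmulRec

/-- Krieger's dimension group `D_A`, the group completion of `D_A⁺`. -/
abbrev KriegerGroup (A : Matrix (Fin k) (Fin k) ℕ) [IrredPosEntropy A] : Type :=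
  Algebra.GrothendieckAddGroup (DPlus A)

/-- The homomorphism `θ : D_A⁺ → G_A`. -/
def thetaPlus (A : Matrix (Fin k) (Fin k) ℕ) [IrredPosEntropy A] : DPlus A →+ DimGroup A where
  toFun := thetaFun
  map_zero' := thetaFun_zero
  map_add' := thetaFun_add

/-- The homomorphism `θ : D_A → G_A` induced on group completions. -/
def thetaHom (A : Matrix (Fin k) (Fin k) ℕ) [IrredPosEntropy A] :
    KriegerGroup A →+ DimGroup A := Algebra.GrothendieckAddGroup.lift (thetaPlus A)

theorem thetaHom_of [IrredPosEntropy A] (a : DPlus A) :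
    thetaHom A (Algebra.GrothendieckAddGroup.of a) = thetaPlus A a :=
  DFunLike.congr_fun (Algebra.GrothendieckAddGroup.lift.symm_apply_apply (thetaPlus A)) a

theorem krieger_exists_sub [IrredPosEntropy A] (x : KriegerGroup A) :
    ∃ a b : DPlus A, x =
      Algebra.GrothendieckAddGroup.of a - Algebra.GrothendieckAddGroup.of b := by
  obtain ⟨⟨a, b⟩, h⟩ := (AddLocalization.addMonoidOf (⊤ : AddSubmonoid (DPlus A))).surj x
  exact ⟨a, b.1, eq_sub_of_add_eq h⟩

/-- For a nonnegative integer vector `w`, the element `δ_A^{-k-n}(w Aᵏ)` is in the image of `θ`. -/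
theorem exists_thetaPlus_eq [IrredPosEntropy A] (w : Fin k → ℕ) (n : ℤ) :
    ∃ a, thetaPlus A a = (delta A ^ (-(k : ℤ) - n)) (ofVec A fun i => (w i : ℤ)) := by
  obtain ⟨U, hU, -, hw⟩ := exists_beam (isBeam_empty (A := A) n) w
  refine ⟨beamClass ⟨U, n, hU⟩, (thetaFun_beamClass ⟨U, n, hU⟩ hU).trans ?_⟩
  have hv : intVec U n = fun i => (w i : ℤ) := by
    funext i
    simp only [intVec, hw]
  rw [thetaAt, hv]

theorem eq_delta_zpow {x : DimGroup A} {n : ℕ} {z : Fin k → ℤ}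
    (hz : (x : Fin k → ℚ) ᵥ* ratMat A ^ n = fun i => (z i : ℚ)) :
    x = (delta A ^ (-(k : ℤ) - (n : ℤ))) (ofVec A z) := by
  have h : ofVec A z = (delta A ^ (k + n)) x := by
    apply Subtype.ext
    rw [ofVec_coe, delta_pow_coe, ← hz, Matrix.vecMul_vecMul, ← pow_add, add_comm]
  rw [h, ← zpow_natCast, ← LinearEquiv.mul_apply, ← zpow_add]
  simp

theorem thetaHom_bijective (A : Matrix (Fin k) (Fin k) ℕ) [IrredPosEntropy A] :
    Function.Bijective (thetaHom A) := by
  constructor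
  · rw [injective_iff_map_eq_zero]
    intro x hx
    obtain ⟨a, b, rfl⟩ := krieger_exists_sub x
    rw [map_sub, thetaHom_of, thetaHom_of, sub_eq_zero] at hx
    rw [thetaFun_injective hx, sub_self]
  · intro x
    obtain ⟨n, z, hz⟩ := x.2.2
    obtain ⟨a, ha⟩ := exists_thetaPlus_eq (A := A) (fun i => (z i).toNat) n
    obtain ⟨b, hb⟩ := exists_thetaPlus_eq (A := A) (fun i => (-z i).toNat) n
    refine ⟨Algebra.GrothendieckAddGroup.of a - Algebra.GrothendieckAddGroup.of b, ?_⟩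
    rw [map_sub, thetaHom_of, thetaHom_of, ha, hb, ← map_sub, ← map_sub, eq_delta_zpow hz]
    congr 2
    funext i
    simp only [Pi.sub_apply]
    omega

/-- The isomorphism `θ : D_A → G_A`. -/
def theta (A : Matrix (Fin k) (Fin k) ℕ) [IrredPosEntropy A] : KriegerGroup A ≃+ DimGroup A :=
  AddEquiv.ofBijective (thetaHom A) (thetaHom_bijective A)

/-! ## The dimension representation -/

/-- The image `φ(U)` of a beam. -/
def Beam.image (φ : ShiftAut A) (U : Beam A) : Beam A :=
  ⟨φ.1 '' U.1, by
    obtain ⟨m, h⟩ := U.2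
    exact h.image φ⟩

/-- `φ_* : D_A⁺ → D_A⁺`, `φ_*([U]) = [φ(U)]`. -/
def pushPlus [IrredPosEntropy A] (φ : ShiftAut A) : DPlus A →+ DPlus A where
  toFun := Quotient.map (Beam.image φ) fun _ _ h => BeamEquiv.image φ h
  map_zero' := by
    change beamClass (Beam.image φ ⟨∅, 0, isBeam_empty 0⟩) = beamClass ⟨∅, 0, isBeam_empty 0⟩
    congr 1
    apply Subtype.ext
    simp [Beam.image]
  map_add' a b := by
    obtain ⟨U, V, rfl, rfl, hd⟩ := exists_disjoint_rep a b
    rw [beamClass_add hd]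
    change beamClass (Beam.image φ (U.union V))
      = beamClass (Beam.image φ U) + beamClass (Beam.image φ V)
    rw [beamClass_add ((Set.disjoint_image_iff φ.1.injective).2 hd)]
    congr 1
    apply Subtype.ext
    exact Set.image_union _ _ _

theorem pushPlus_beamClass [IrredPosEntropy A] (φ : ShiftAut A) (U : Beam A) :
    pushPlus φ (beamClass U) = beamClass (Beam.image φ U) := rfl

/-- `φ_* : D_A → D_A`. -/
def push [IrredPosEntropy A] (φ : ShiftAut A) : KriegerGroup A →+ KriegerGroup A :=
  Algebra.GrothendieckAddGroup.lift (Algebra.GrothendieckAddGroup.of.comp (pushPlus φ))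

theorem push_of [IrredPosEntropy A] (φ : ShiftAut A) (a : DPlus A) :
    push φ (Algebra.GrothendieckAddGroup.of a) = Algebra.GrothendieckAddGroup.of (pushPlus φ a) :=
  DFunLike.congr_fun (Algebra.GrothendieckAddGroup.lift.symm_apply_apply
    (Algebra.GrothendieckAddGroup.of.comp (pushPlus φ))) a

theorem pushPlus_one [IrredPosEntropy A] (a : DPlus A) : pushPlus (1 : ShiftAut A) a = a := by
  obtain ⟨U, rfl⟩ := Quotient.exists_rep a
  change beamClass (Beam.image 1 U) = beamClass U
  congr 1
  apply Subtype.ext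
  exact Set.image_id U.1

theorem pushPlus_mul [IrredPosEntropy A] (φ ψ : ShiftAut A) (a : DPlus A) :
    pushPlus (φ * ψ) a = pushPlus φ (pushPlus ψ a) := by
  obtain ⟨U, rfl⟩ := Quotient.exists_rep a
  change beamClass (Beam.image (φ * ψ) U) = beamClass (Beam.image φ (Beam.image ψ U))
  congr 1
  apply Subtype.ext
  exact Set.image_comp φ.1 ψ.1 U.1

theorem push_one [IrredPosEntropy A] (x : KriegerGroup A) : push (1 : ShiftAut A) x = x := by
  obtain ⟨a, b, rfl⟩ := krieger_exists_sub x
  rw [map_sub, push_of, push_of, pushPlus_one, pushPlus_one]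

theorem push_mul [IrredPosEntropy A] (φ ψ : ShiftAut A) (x : KriegerGroup A) :
    push (φ * ψ) x = push φ (push ψ x) := by
  obtain ⟨a, b, rfl⟩ := krieger_exists_sub x
  simp only [map_sub, push_of, pushPlus_mul]

/-- `φ_*` as an automorphism of the group `D_A`. -/
def pushEquiv [IrredPosEntropy A] (φ : ShiftAut A) : KriegerGroup A ≃+ KriegerGroup A where
  toFun := push φ
  invFun := push φ⁻¹
  left_inv x := by rw [← push_mul, inv_mul_cancel, push_one]
  right_inv x := by rw [← push_mul, mul_inv_cancel, push_one]
  map_add' := map_add _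

/-- `S_φ = θ ∘ φ_* ∘ θ⁻¹`, as an automorphism of the group `G_A`. -/
def dimAction [IrredPosEntropy A] (φ : ShiftAut A) : DimGroup A ≃ₗ[ℤ] DimGroup A :=
  (((theta A).symm.trans (pushEquiv φ)).trans (theta A)).toIntLinearEquiv

theorem dimAction_theta [IrredPosEntropy A] (φ : ShiftAut A) (x : KriegerGroup A) :
    dimAction φ (theta A x) = theta A (push φ x) := by
  change theta A (push φ ((theta A).symm (theta A x))) = _
  rw [AddEquiv.symm_apply_apply]

theorem dimAction_thetaPlus [IrredPosEntropy A] (φ : ShiftAut A) (a : DPlus A) :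
    dimAction φ (thetaPlus A a) = thetaPlus A (pushPlus φ a) := by
  rw [← thetaHom_of, ← thetaHom_of, ← push_of]
  exact dimAction_theta φ _

theorem dimAction_mul [IrredPosEntropy A] (φ ψ : ShiftAut A) :
    dimAction (φ * ψ) = dimAction φ * dimAction ψ := by
  ext1 x
  obtain ⟨y, rfl⟩ := (theta A).surjective x
  rw [LinearEquiv.mul_apply, dimAction_theta, dimAction_theta, dimAction_theta, push_mul]

theorem dimAction_one [IrredPosEntropy A] : dimAction (1 : ShiftAut A) = 1 := by
  ext1 x
  obtain ⟨y, rfl⟩ := (theta A).surjective x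
  rw [dimAction_theta, push_one]
  rfl

theorem ofVec_nat_mem_dimPos (w : Fin k → ℕ) (n : ℤ) :
    (delta A ^ n) (ofVec A fun i => (w i : ℤ)) ∈ dimPos A := by
  refine ⟨n.natAbs, w ᵥ* A ^ (n + n.natAbs + k).toNat, ?_⟩
  rw [← delta_pow_coe, ← LinearEquiv.mul_apply, ← zpow_natCast, ← zpow_add]
  obtain ⟨p, hp⟩ := Int.eq_ofNat_of_zero_le (show 0 ≤ (n.natAbs : ℤ) + n by omega)
  rw [hp, zpow_natCast, delta_pow_coe, ofVec_coe, Matrix.vecMul_vecMul, ← pow_add,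
    show (n + n.natAbs + k).toNat = k + p by omega]
  have h := RingHom.map_vecMul (Nat.castRingHom ℚ) (A ^ (k + p)) w
  have h2 : (A ^ (k + p)).map (Nat.castRingHom ℚ) = ratMat A ^ (k + p) := by
    rw [Matrix.map_pow]
    rfl
  rw [h2] at h
  funext i
  refine Eq.trans ?_ (h i).symm
  congr 1

/-- `θ(D_A⁺) = G_A⁺`. -/
theorem range_thetaPlus [IrredPosEntropy A] : Set.range (thetaPlus A) = dimPos A := by
  apply Set.Subset.antisymm
  · rintro _ ⟨a, rfl⟩
    obtain ⟨U, rfl⟩ := Quotient.exists_rep a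
    exact ofVec_nat_mem_dimPos (beamVec U.1 _) _
  · rintro x ⟨n, w, hw⟩
    obtain ⟨a, ha⟩ := exists_thetaPlus_eq (A := A) w n
    refine ⟨a, ha.trans (eq_delta_zpow ?_).symm⟩
    rw [hw]
    funext i
    simp

/-- The shift as an automorphism of itself. -/
def shiftAut (A : Matrix (Fin k) (Fin k) ℕ) : ShiftAut A :=
  ⟨shift A, Subgroup.mem_centralizer_singleton_iff.2 rfl⟩

theorem shift_image_aux {m : ℤ} {U : Set (X A)} (hU : IsBeam (m + 1) U) :
    IsBeam m (shift A '' U) ∧ ∀ J, raysIn (shift A '' U) m J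
      = (fun R => shift A '' R) '' raysIn U (m + 1) J := by
  have hray : ∀ x : X A, ray (shift A x) m = shift A '' ray x (m + 1) := by
    intro x
    ext y
    constructor
    · intro h
      refine ⟨(shift A).symm y, fun i hi => ?_, (shift A).apply_symm_apply y⟩
      rw [shift_symm_apply, h (i - 1) (by omega), shift_apply, sub_add_cancel]
    · rintro ⟨z, hz, rfl⟩ i hi
      rw [shift_apply, shift_apply, hz _ (by omega)]
  constructor
  · obtain ⟨s, hs, rfl⟩ := hU
    refine ⟨shift A '' s, hs.image _, ?_⟩
    rw [Set.image_iUnion₂, Set.biUnion_image]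
    simp only [hray]
  · intro J
    ext R
    constructor
    · rintro ⟨_, ⟨⟨x, hx, rfl⟩, hJ⟩, rfl⟩
      exact ⟨_, ⟨x, ⟨hx, hJ⟩, rfl⟩, (hray x).symm⟩
    · rintro ⟨_, ⟨x, ⟨hx, hJ⟩, rfl⟩, rfl⟩
      exact ⟨shift A x, ⟨⟨x, hx, rfl⟩, hJ⟩, hray x⟩

/-- `θ ∘ d_A = δ_A ∘ θ`, where `d_A([U]) = [σ_A(U)]`. -/
theorem thetaPlus_shift [IrredPosEntropy A] (a : DPlus A) :
    thetaPlus A (pushPlus (shiftAut A) a) = delta A (thetaPlus A a) := by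
  obtain ⟨U, rfl⟩ := Quotient.exists_rep a
  obtain ⟨m, hU⟩ := U.2
  have h1 : IsBeam (m - 1 + 1) U.1 := by rwa [sub_add_cancel]
  obtain ⟨h2, h3⟩ := shift_image_aux h1
  refine (thetaFun_beamClass (Beam.image (shiftAut A) U) h2).trans ?_
  refine Eq.trans ?_ (congrArg (delta A) (thetaFun_beamClass U hU).symm)
  have hv : intVec (Beam.image (shiftAut A) U).1 (m - 1) = intVec U.1 m := by
    funext J
    rw [intVec, intVec, beamVec, beamVec]
    rw [show raysIn (Beam.image (shiftAut A) U).1 (m - 1) J = _ from h3 J, sub_add_cancel,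
      Set.InjOn.ncard_image]
    exact ((Set.image_injective.2 (shift A).injective)).injOn
  rw [thetaAt, thetaAt, hv, ← LinearEquiv.mul_apply, ← zpow_one_add]
  congr 2
  ring

theorem dimAction_shift [IrredPosEntropy A] : dimAction (shiftAut A) = delta A := by
  ext1 x
  obtain ⟨y, rfl⟩ := (theta A).surjective x
  obtain ⟨a, b, rfl⟩ := krieger_exists_sub y
  have h : ∀ c : DPlus A, theta A (Algebra.GrothendieckAddGroup.of c) = thetaPlus A c :=
    thetaHom_of
  rw [map_sub, h, h, map_sub, map_sub, dimAction_thetaPlus, dimAction_thetaPlus, thetaPlus_shift,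
    thetaPlus_shift]

theorem dimAction_mem [IrredPosEntropy A] (φ : ShiftAut A) : dimAction φ ∈ DimAut A := by
  constructor
  · have hsub : ∀ ψ : ShiftAut A, dimAction ψ '' dimPos A ⊆ dimPos A := by
      intro ψ
      rw [← range_thetaPlus]
      rintro _ ⟨_, ⟨a, rfl⟩, rfl⟩
      exact ⟨_, (dimAction_thetaPlus ψ a).symm⟩
    refine Set.Subset.antisymm (hsub φ) fun x hx => ?_
    refine ⟨dimAction φ⁻¹ x, hsub φ⁻¹ ⟨x, hx, rfl⟩, ?_⟩
    rw [← LinearEquiv.mul_apply, ← dimAction_mul, mul_inv_cancel, dimAction_one]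
    rfl
  · rw [← dimAction_shift, ← dimAction_mul, ← dimAction_mul]
    congr 1
    exact Subtype.ext (Subgroup.mem_centralizer_singleton_iff.1 φ.2)

/-- The dimension representation `π_A : Aut(σ_A) → Aut(G_A, G_A⁺, δ_A)`, `φ ↦ S_φ`. -/
def dimRep (A : Matrix (Fin k) (Fin k) ℕ) [IrredPosEntropy A] : ShiftAut A →* DimAut A where
  toFun φ := ⟨dimAction φ, dimAction_mem φ⟩
  map_one' := Subtype.ext dimAction_one
  map_mul' φ ψ := Subtype.ext (dimAction_mul φ ψ)

end EdgeShift

end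

/-!
If `α⁻(φ) = α⁻(φ⁻¹) = 0`, then `φⁿ` and `φ⁻ⁿ` move left half-lines by at most `o(n)`. Hence `φⁿ`
maps an `m`-beam `U` to an `(m + o(n))`-beam consisting of at most `exp (o(n))` rays, and since
`θ([φⁿ U])` is computed from the ray counts by `o(n)` applications of `δ_A⁻¹`, its norm in `ℚᵏ` is
at most `exp (o(n))`. The classes of beams generate the dimension group, so every orbit of `S_φ` on
`ℂ ⊗ G_A ⊆ ℂᵏ` grows subexponentially, which excludes eigenvalues of modulus greater than one. The
same applies to `φ⁻¹`, whose eigenvalues are the inverses.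
-/

namespace EdgeShift

open Filter Asymptotics Set
open scoped TensorProduct NNReal

/-! ### Eigenvalues and growth of orbits -/

section Spectral

variable {𝕜 E F : Type*} [NormedField 𝕜] [AddCommGroup E] [Module 𝕜 E] [NormedAddCommGroup F]
  [NormedSpace 𝕜 F]

theorem norm_le_of_hasEigenvector_of_isBigO {T : Module.End 𝕜 E} {μ : 𝕜} {w : E}
    (hw : T.HasEigenvector μ w) {L : E →ₗ[𝕜] F} (hL : Function.Injective L) {r : ℝ}
    (hr : 0 ≤ r) (hT : (fun n : ℕ => L ((T ^ n) w)) =O[atTop] fun n : ℕ => r ^ n) : ‖μ‖ ≤ r := by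
  by_contra! hlt
  have hLw : L w ≠ 0 := (map_ne_zero_iff L hL).2 hw.2
  have hμ : (fun n : ℕ => ‖μ‖ ^ n) =O[atTop] fun n : ℕ => L ((T ^ n) w) :=
    .of_bound ‖L w‖⁻¹ <| .of_forall fun n => by
      rw [hw.pow_apply, map_smul, norm_smul, mul_comm, mul_assoc,
        mul_inv_cancel₀ (norm_ne_zero_iff.2 hLw), mul_one, norm_pow, norm_pow, norm_norm]
  have hself : (fun n : ℕ => ‖μ‖ ^ n) =o[atTop] fun n : ℕ => ‖μ‖ ^ n :=
    (hμ.trans hT).trans_isLittleO (isLittleO_pow_pow_of_lt_left hr hlt)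
  have hne (n : ℕ) : ‖μ‖ ^ n ≠ 0 := (pow_pos (hr.trans_lt hlt) n).ne'
  exact isLittleO_irrefl (Eventually.of_forall hne).frequently hself

theorem ne_zero_and_hasEigenvector_symm {K M : Type*} [Field K] [AddCommGroup M] [Module K M]
    {f : M ≃ₗ[K] M} {μ : K} {w : M} (hw : Module.End.HasEigenvector f.toLinearMap μ w) :
    μ ≠ 0 ∧ Module.End.HasEigenvector f.symm.toLinearMap μ⁻¹ w := by
  have hf : f w = μ • w := hw.apply_eq_smul
  have hμ : μ ≠ 0 := by
    rintro rfl
    exact hw.2 ((map_eq_zero_iff f f.injective).1 (hf.trans (zero_smul K w)))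
  refine ⟨hμ, Module.End.hasEigenvector_iff.2 ⟨Module.End.mem_eigenspace_iff.2 ?_, hw.2⟩⟩
  rw [LinearEquiv.coe_coe, LinearEquiv.symm_apply_eq, map_smul, hf, inv_smul_smul₀ hμ]

end Spectral

section BaseChange

variable (𝕜 : Type*) {ι : Type*} [NormedField 𝕜] [NormedAlgebra ℚ 𝕜]
  (G : AddSubgroup (ι → ℚ))

/-- The coordinates `c ⊗ g ↦ c g` on the scalar extension of a subgroup of `ℚ^ι`, through which
`𝕜 ⊗ G` is measured by the sup norm of `𝕜^ι`. -/
def baseChangeCoords : 𝕜 ⊗[ℤ] G →ₗ[𝕜] (ι → 𝕜) :=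
  LinearMap.liftBaseChange 𝕜
    (((algebraMap ℚ 𝕜).compLeft ι).toAddMonoidHom.comp G.subtype).toIntLinearMap

variable {𝕜 G}

theorem baseChangeCoords_tmul (c : 𝕜) (g : G) :
    baseChangeCoords 𝕜 G (c ⊗ₜ g) = fun i => c * algebraMap ℚ 𝕜 (g.1 i) :=
  rfl

theorem baseChangeCoords_injective [Finite ι] : Function.Injective (baseChangeCoords 𝕜 G) := by
  classical
  have := Fintype.ofFinite ι
  -- `CharZero 𝕜` stays local, since it brings a second `Algebra ℚ 𝕜` instance with it.
  have : Module.Flat ℤ 𝕜 :=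
    have := algebraRat.charZero 𝕜
    inferInstance
  let e := IsLocalization.moduleTensorEquiv (nonZeroDivisors ℤ) ℚ 𝕜 (ι → ℚ)
  let incl := LinearMap.lTensor 𝕜 G.subtype.toIntLinearMap
  have hincl : Function.Injective incl :=
    Module.Flat.lTensor_preserves_injective_linearMap _ Subtype.val_injective
  have hfactor : ⇑(baseChangeCoords 𝕜 G) =
      TensorProduct.piScalarRight ℚ ℚ 𝕜 ι ∘ e.symm ∘ incl := by
    funext w
    induction w with
    | zero => simp
    | add v w hv hw => simp only [map_add, hv, hw, Function.comp_apply]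
    | tmul c g =>
      have he : e.symm (c ⊗ₜ g.1) = c ⊗ₜ g.1 := by
        rw [LinearEquiv.symm_apply_eq]
        rfl
      funext i
      simp [incl, he, baseChangeCoords_tmul, Algebra.smul_def, mul_comm]
  rw [hfactor]
  exact (LinearEquiv.injective _).comp (e.symm.injective.comp hincl)

variable [Fintype ι]

theorem norm_baseChangeCoords_tmul_le (c : 𝕜) (g : G) :
    ‖baseChangeCoords 𝕜 G (c ⊗ₜ g)‖ ≤ ‖c‖ * ‖g‖ := by
  refine (pi_norm_le_iff_of_nonneg (by positivity)).2 fun i => ?_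
  rw [baseChangeCoords_tmul, norm_mul, norm_algebraMap']
  exact mul_le_mul_of_nonneg_left (norm_le_pi_norm g.1 i) (norm_nonneg c)

theorem norm_le_of_hasEigenvector_baseChange {S : Module.End ℤ G} {r : ℝ} (hr : 0 ≤ r)
    (hS : ∀ g, (fun n : ℕ => (S ^ n) g) =O[atTop] fun n : ℕ => r ^ n) {μ : 𝕜} {w : 𝕜 ⊗[ℤ] G}
    (hw : Module.End.HasEigenvector (S.baseChange 𝕜) μ w) : ‖μ‖ ≤ r := by
  have horbit (v : 𝕜 ⊗[ℤ] G) :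
      (fun n : ℕ => baseChangeCoords 𝕜 G ((S.baseChange 𝕜 ^ n) v)) =O[atTop]
        fun n : ℕ => r ^ n := by
    induction v with
    | zero => simpa only [map_zero] using isBigO_zero (E' := ι → 𝕜) _ _
    | add u v hu hv => simpa only [map_add] using hu.add hv
    | tmul c g =>
      refine (IsBigO.of_bound ‖c‖ (.of_forall fun n => ?_)).trans (hS g)
      rw [← LinearMap.baseChange_pow, LinearMap.baseChange_tmul]
      exact norm_baseChangeCoords_tmul_le c _
  exact norm_le_of_hasEigenvector_of_isBigO hw baseChangeCoords_injective hr (horbit w)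

theorem norm_eq_one_of_hasEigenvalue_baseChange {S : G ≃ₗ[ℤ] G}
    (hS : ∀ r : ℝ, 1 < r → ∀ g, (fun n : ℕ => (S ^ n) g) =O[atTop] fun n : ℕ => r ^ n)
    (hS' : ∀ r : ℝ, 1 < r → ∀ g, (fun n : ℕ => (S⁻¹ ^ n) g) =O[atTop] fun n : ℕ => r ^ n)
    {μ : 𝕜} (hμ : Module.End.HasEigenvalue (S.toLinearMap.baseChange 𝕜) μ) : ‖μ‖ = 1 := by
  have norm_le_one {T : G ≃ₗ[ℤ] G} {ν : 𝕜} {w : 𝕜 ⊗[ℤ] G}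
      (hT : ∀ r : ℝ, 1 < r → ∀ g, (fun n : ℕ => (T ^ n) g) =O[atTop] fun n : ℕ => r ^ n)
      (hw : Module.End.HasEigenvector (T.toLinearMap.baseChange 𝕜) ν w) : ‖ν‖ ≤ 1 :=
    le_of_forall_gt_imp_ge_of_dense fun r hr =>
      norm_le_of_hasEigenvector_baseChange (zero_le_one.trans hr.le)
        (by simpa only [Module.End.coe_pow, LinearEquiv.coe_pow, LinearEquiv.coe_coe] using hT r hr)
        hw
  obtain ⟨w, hw⟩ := hμ.exists_hasEigenvector
  obtain ⟨hμ0, hw'⟩ := ne_zero_and_hasEigenvector_symm (f := S.baseChange ℤ 𝕜 G G) hw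
  have hinv : ‖μ⁻¹‖ ≤ 1 := norm_le_one hS' hw'
  rw [norm_inv] at hinv
  exact (norm_le_one hS hw).antisymm ((inv_le_one₀ (norm_pos_iff.2 hμ0)).1 hinv)

end BaseChange

variable {k : ℕ} {A : Matrix (Fin k) (Fin k) ℕ} {φ : ShiftAut A} {U : Set (X A)}

/-! ### Coding of left half-lines -/

theorem shift_zpow_apply (m : ℤ) (x : X A) (i : ℤ) : ((shift A ^ m) x).1 i = x.1 (i + m) := by
  induction m generalizing x with
  | zero => simp
  | succ n ih => rw [zpow_add_one, Homeomorph.mul_apply, ih, shift_apply, add_assoc]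
  | pred n ih =>
    rw [zpow_sub_one, Homeomorph.mul_apply, ih]
    exact (shift_symm_apply x _).trans (by rw [add_sub_assoc])

theorem ShiftAut.comm_zpow (φ : ShiftAut A) (m : ℤ) (x : X A) :
    φ.1 ((shift A ^ m) x) = (shift A ^ m) (φ.1 x) :=
  have h : Commute φ.1 (shift A) := Subgroup.mem_centralizer_singleton_iff.1 φ.2
  DFunLike.congr_fun (h.zpow_right m).eq x

theorem Codes.preimage_sub_const {S T : Set ℤ} (h : Codes φ.1 S T) (m : ℤ) :
    Codes φ.1 ((· - m) ⁻¹' S) ((· - m) ⁻¹' T) := by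
  intro x y hxy i hi
  have hshift := h ((shift A ^ m) x) ((shift A ^ m) y) (fun j hj => by
    simpa only [shift_zpow_apply] using
      hxy (j + m) (by rwa [mem_preimage, add_sub_cancel_right])) (i - m) hi
  simpa only [ShiftAut.comm_zpow, shift_zpow_apply, sub_add_cancel] using hshift

theorem Codes.ray_eq {p : ℤ} (h : Codes φ.1 (Iic 0) (Iic (-p))) {m : ℤ} {x y : X A}
    (hxy : ray x (m + p) = ray y (m + p)) : ray (φ.1 x) m = ray (φ.1 y) m := by
  have hm := h.preimage_sub_const (m + p)
  simp only [preimage_sub_const_Iic, zero_add, neg_add_cancel_comm_assoc] at hm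
  exact ray_eq_iff.2 (hm x y (ray_eq_iff.1 hxy))

theorem HasLyapunovMinus.eventually_codes {a : EReal} (h : HasLyapunovMinus φ a) {ε : ℝ}
    (hε : 0 ≤ ε) (hεa : ((-ε : ℝ) : EReal) < a) :
    ∀ᶠ n : ℕ in atTop, Codes (φ ^ n).1 (Iic 0) (Iic (-(⌊ε * n⌋₊ : ℤ))) := by
  filter_upwards [h.eventually_const_lt hεa, eventually_gt_atTop 0] with n hn hn0
  have hW : ((-ε * n : ℝ) : EReal) < WMinus n φ := by
    rwa [EReal.lt_div_iff (by exact_mod_cast hn0) (EReal.natCast_ne_top n),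
      ← EReal.coe_coe_eq_natCast, ← EReal.coe_mul] at hn
  obtain ⟨_, ⟨m, hm, rfl⟩, hlt⟩ := lt_sSup_iff.1 hW
  have hmε : -m ≤ ⌊ε * n⌋ := by
    have : -ε * n < m := EReal.coe_lt_coe_iff.1 hlt
    rw [Int.le_floor]
    push_cast
    linarith
  rw [Int.natCast_floor_eq_floor (by positivity)]
  exact fun x y hxy j hj => hm x y hxy j (le_trans hj (neg_le.1 hmε))

/-! ### Counting rays -/

/-- The set of `m`-rays through the points of `U`; for an `m`-beam these are the rays whose union
is `U`. -/
def rays (U : Set (X A)) (m : ℤ) : Set (Set (X A)) := (fun x => ray x m) '' U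

theorem IsBeam.finite_rays {m : ℤ} (hU : IsBeam m U) : (rays U m).Finite :=
  (isBeam_iff.1 hU).2

theorem IsBeam.beamVec_le_ncard_rays {m : ℤ} (hU : IsBeam m U) (J : Fin k) :
    beamVec U m J ≤ (rays U m).ncard :=
  ncard_le_ncard (image_mono fun _ hx => hx.1) hU.finite_rays

theorem IsBeam.ncard_rays_succ_le {m : ℤ} (hU : IsBeam m U) :
    (rays U (m + 1)).ncard ≤ (rays U m).ncard * Nat.card (Edge A) := by
  have hfin := hU.finite_rays.prod (finite_univ (α := Edge A))
  have hsub : (fun x : X A => (ray x m, x.1 (m + 1))) '' U ⊆ rays U m ×ˢ univ := by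
    rintro _ ⟨x, hx, rfl⟩
    exact ⟨mem_image_of_mem _ hx, mem_univ _⟩
  calc (rays U (m + 1)).ncard
      ≤ ((fun x : X A => (ray x m, x.1 (m + 1))) '' U).ncard :=
        (image_finite_and_ncard_le (hfin.subset hsub)
          fun x _ y _ hxy => (ray_succ_iff x y m).1 hxy).2
    _ ≤ (rays U m ×ˢ univ).ncard := ncard_le_ncard hsub hfin
    _ = (rays U m).ncard * Nat.card (Edge A) := by rw [ncard_prod, ncard_univ]

theorem IsBeam.ncard_rays_add_le {m : ℤ} (hU : IsBeam m U) (n : ℕ) :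
    (rays U (m + n)).ncard ≤ (rays U m).ncard * Nat.card (Edge A) ^ n := by
  induction n with
  | zero => simp
  | succ n ih =>
    rw [Nat.cast_succ, ← add_assoc, pow_succ, ← mul_assoc]
    exact (hU.mono (by lia)).ncard_rays_succ_le.trans (Nat.mul_le_mul_right _ ih)

theorem rays_image_finite_and_ncard_le {p m : ℤ} (h : Codes φ.1 (Iic 0) (Iic (-p)))
    (hU : (rays U (m + p)).Finite) :
    (rays (φ.1 '' U) m).Finite ∧ (rays (φ.1 '' U) m).ncard ≤ (rays U (m + p)).ncard := by
  simp only [rays, image_image]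
  exact image_finite_and_ncard_le hU fun x _ y _ hxy => h.ray_eq hxy

theorem IsBeam.image_of_codes {p q m : ℤ} (h : Codes φ.1 (Iic 0) (Iic (-p)))
    (h' : Codes φ⁻¹.1 (Iic 0) (Iic (-q))) (hpq : 0 ≤ q + p) (hU : IsBeam m U) :
    IsBeam (m + q) (φ.1 '' U) := by
  refine isBeam_iff.2
    ⟨?_, (rays_image_finite_and_ncard_le h (hU.mono (by lia)).finite_rays).1⟩
  rintro _ ⟨x, hx, rfl⟩ y hy
  have hinv : φ⁻¹.1 (φ.1 x) = x := φ.1.symm_apply_apply x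
  have hray : ray (φ⁻¹.1 y) m = ray x m := by
    rw [← hinv]
    exact h'.ray_eq (ray_eq_iff.2 hy)
  exact ⟨φ⁻¹.1 y, (isBeam_iff.1 hU).1 x hx (hray ▸ self_mem_ray _ _), φ.1.apply_symm_apply y⟩

theorem IsBeam.ncard_rays_image_le {p : ℕ} {m : ℤ} (h : Codes φ.1 (Iic 0) (Iic (-p : ℤ)))
    (hU : IsBeam m U) (q : ℕ) :
    (rays (φ.1 '' U) (m + q)).ncard ≤ (rays U m).ncard * Nat.card (Edge A) ^ (q + p) :=
  calc (rays (φ.1 '' U) (m + q)).ncard ≤ (rays U (m + q + p)).ncard :=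
        (rays_image_finite_and_ncard_le h (hU.mono (by lia)).finite_rays).2
    _ = (rays U (m + (q + p : ℕ))).ncard := by rw [Nat.cast_add, add_assoc]
    _ ≤ (rays U m).ncard * Nat.card (Edge A) ^ (q + p) := hU.ncard_rays_add_le (q + p)

/-! ### Norms on the dimension group and growth of orbits -/

theorem antilipschitzWith_iterate {α : Type*} [PseudoEMetricSpace α] {K : ℝ≥0} {f : α → α}
    (hf : AntilipschitzWith K f) (n : ℕ) : AntilipschitzWith (K ^ n) f^[n] := by
  induction n with
  | zero => simpa only [pow_zero, Function.iterate_zero] using AntilipschitzWith.id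
  | succ n ih => simpa only [pow_succ', Function.iterate_succ] using ih.comp hf

theorem exists_antilipschitzWith_of_injective {𝕜 ι V : Type*} [NontriviallyNormedField 𝕜]
    [Fintype ι] [SeminormedAddCommGroup V] [NormedSpace 𝕜 V] {f : V →ₗ[𝕜] (ι → 𝕜)}
    (hf : Function.Injective f) : ∃ K : ℝ≥0, AntilipschitzWith K f := by
  obtain ⟨g, hg⟩ := f.exists_leftInverse_of_injective (LinearMap.ker_eq_bot.2 hf)
  let g' : (ι → 𝕜) →L[𝕜] V := ⟨g, g.continuous_on_pi⟩
  exact ⟨‖g'‖₊, g'.lipschitz.to_rightInverse (LinearMap.congr_fun hg)⟩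

theorem exists_antilipschitzWith_delta (A : Matrix (Fin k) (Fin k) ℕ) :
    ∃ K : ℝ≥0, AntilipschitzWith K (delta A) := by
  let T := (Matrix.vecMulLinear (ratMat A)).domRestrict (eventualRange A)
  have hT : Function.Injective T := (injective_iff_map_eq_zero T).2 fun x hx =>
    Subtype.ext (eventualRange_inj x.2 hx)
  obtain ⟨K, hK⟩ := exists_antilipschitzWith_of_injective hT
  exact ⟨K, fun g h => hK ⟨g.1, g.2.1⟩ ⟨h.1, h.2.1⟩⟩

theorem norm_intCast_le {ι : Type*} [Fintype ι] (v : ι → ℤ) : ‖fun i => (v i : ℚ)‖ ≤ ‖v‖ :=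
  (pi_norm_le_iff_of_nonneg (norm_nonneg v)).2 fun i => by
    simpa using norm_le_pi_norm v i

theorem exists_norm_ofVec_le (A : Matrix (Fin k) (Fin k) ℕ) :
    ∃ C : ℝ≥0, ∀ v, ‖ofVec A v‖ ≤ C * ‖v‖ := by
  let T : (Fin k → ℚ) →L[ℚ] (Fin k → ℚ) :=
    ⟨Matrix.vecMulLinear (ratMat A ^ k), LinearMap.continuous_on_pi _⟩
  exact ⟨‖T‖₊, fun v => (T.le_opNorm _).trans <|
    mul_le_mul_of_nonneg_left (norm_intCast_le v) (norm_nonneg T)⟩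

theorem IsBeam.norm_intVec_le {m : ℤ} (hU : IsBeam m U) :
    ‖intVec U m‖ ≤ (rays U m).ncard :=
  (pi_norm_le_iff_of_nonneg (Nat.cast_nonneg _)).2 fun J => by
    simpa [intVec] using hU.beamVec_le_ncard_rays J

variable [IrredPosEntropy A]

theorem delta_pow_thetaPlus {U : Beam A} {m : ℕ} (hU : IsBeam m U.1) :
    (delta A ^ (k + m)) (thetaPlus A (beamClass U)) = ofVec A (intVec U.1 m) := by
  have hθ : thetaPlus A (beamClass U) = thetaAt U.1 m := thetaFun_beamClass U hU
  rw [hθ, thetaAt, ← zpow_natCast, ← LinearEquiv.mul_apply, ← zpow_add]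
  simp

theorem exists_norm_thetaPlus_le (A : Matrix (Fin k) (Fin k) ℕ) [IrredPosEntropy A] :
    ∃ C K : ℝ≥0, ∀ (m : ℕ) (U : Beam A), IsBeam m U.1 →
      ‖thetaPlus A (beamClass U)‖ ≤ C * K ^ m * (rays U.1 m).ncard := by
  obtain ⟨K, hK⟩ := exists_antilipschitzWith_delta A
  obtain ⟨C, hC⟩ := exists_norm_ofVec_le A
  refine ⟨K ^ k * C, K, fun m U hU => ?_⟩
  have hpow : AntilipschitzWith (K ^ (k + m)) ⇑(delta A ^ (k + m)) := by
    rw [LinearEquiv.coe_pow]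
    exact antilipschitzWith_iterate hK _
  calc ‖thetaPlus A (beamClass U)‖
      ≤ K ^ (k + m) * ‖(delta A ^ (k + m)) (thetaPlus A (beamClass U))‖ := by
        exact_mod_cast ZeroHomClass.bound_of_antilipschitz _ hpow _
    _ ≤ K ^ (k + m) * (C * (rays U.1 m).ncard) := by
        rw [delta_pow_thetaPlus hU]
        gcongr
        exact (hC _).trans (by gcongr; exact hU.norm_intVec_le)
    _ = (K ^ k * C : ℝ≥0) * K ^ m * (rays U.1 m).ncard := by
        push_cast
        ring

theorem exists_pow_floor_mul_le {M r : ℝ} (hM : 0 ≤ M) (hr : 1 < r) :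
    ∃ ε : ℝ, 0 < ε ∧ ∀ n : ℕ, M ^ ⌊ε * n⌋₊ ≤ r ^ n := by
  obtain ⟨N, hN⟩ := pow_unbounded_of_one_lt M hr
  refine ⟨((N + 1 : ℕ) : ℝ)⁻¹, by positivity, fun n => ?_⟩
  rw [inv_mul_eq_div, Nat.floor_div_eq_div]
  calc M ^ (n / (N + 1)) ≤ (r ^ (N + 1)) ^ (n / (N + 1)) := by
        gcongr
        exact hN.le.trans (pow_le_pow_right₀ hr.le N.le_succ)
    _ = r ^ ((N + 1) * (n / (N + 1))) := (pow_mul _ _ _).symm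
    _ ≤ r ^ n := pow_le_pow_right₀ hr.le (Nat.mul_div_le n (N + 1))

theorem dimAction_pow_thetaPlus (φ : ShiftAut A) (n : ℕ) (U : Beam A) :
    (dimAction φ ^ n) (thetaPlus A (beamClass U)) = thetaPlus A (beamClass (U.image (φ ^ n))) := by
  have hpow : dimAction (φ ^ n) = dimAction φ ^ n := congrArg Subtype.val (map_pow (dimRep A) φ n)
  rw [← hpow, dimAction_thetaPlus, pushPlus_beamClass]

theorem isBigO_dimAction_pow_thetaPlus (h : HasLyapunovMinus φ 0) (h' : HasLyapunovMinus φ⁻¹ 0)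
    {r : ℝ} (hr : 1 < r) (U : Beam A) :
    (fun n : ℕ => (dimAction φ ^ n) (thetaPlus A (beamClass U))) =O[atTop]
      fun n : ℕ => r ^ n := by
  obtain ⟨m, hU⟩ : ∃ m : ℕ, IsBeam m U.1 :=
    ⟨_, U.2.choose_spec.mono (Int.self_le_toNat _)⟩
  obtain ⟨C, K, hθ⟩ := exists_norm_thetaPlus_le A
  obtain ⟨ε, hε, hεr⟩ :=
    exists_pow_floor_mul_le (M := K * Nat.card (Edge A) ^ 2) (by positivity) hr
  have hε0 : ((-ε : ℝ) : EReal) < 0 := by exact_mod_cast neg_neg_of_pos hε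
  refine .of_bound (C * K ^ m * (rays U.1 m).ncard) ?_
  filter_upwards [h.eventually_codes hε.le hε0, h'.eventually_codes hε.le hε0] with n hn hn'
  rw [inv_pow] at hn'
  set p := ⌊ε * n⌋₊
  have hbeam : IsBeam (m + p : ℕ) (U.image (φ ^ n)).1 := by
    exact_mod_cast hU.image_of_codes hn hn' (by positivity)
  have hcount : (rays (U.image (φ ^ n)).1 (m + p : ℕ)).ncard
      ≤ (rays U.1 m).ncard * Nat.card (Edge A) ^ (p + p) := by
    exact_mod_cast hU.ncard_rays_image_le hn p
  rw [dimAction_pow_thetaPlus, Real.norm_of_nonneg (by positivity)]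
  calc ‖thetaPlus A (beamClass (U.image (φ ^ n)))‖
      ≤ C * K ^ (m + p) * (rays (U.image (φ ^ n)).1 (m + p : ℕ)).ncard := hθ _ _ hbeam
    _ ≤ C * K ^ (m + p) * ((rays U.1 m).ncard * Nat.card (Edge A) ^ (p + p)) := by
        gcongr
        exact_mod_cast hcount
    _ = C * K ^ m * (rays U.1 m).ncard * (K * Nat.card (Edge A) ^ 2) ^ p := by ring
    _ ≤ C * K ^ m * (rays U.1 m).ncard * r ^ n := by
        gcongr
        exact hεr n

theorem isBigO_dimAction_pow (h : HasLyapunovMinus φ 0) (h' : HasLyapunovMinus φ⁻¹ 0)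
    {r : ℝ} (hr : 1 < r) (g : DimGroup A) :
    (fun n : ℕ => (dimAction φ ^ n) g) =O[atTop] fun n : ℕ => r ^ n := by
  obtain ⟨x, rfl⟩ := (theta A).surjective g
  obtain ⟨a, b, rfl⟩ := krieger_exists_sub x
  obtain ⟨U, rfl⟩ : ∃ U, beamClass U = a := Quotient.exists_rep a
  obtain ⟨V, rfl⟩ : ∃ V, beamClass V = b := Quotient.exists_rep b
  have hθ (c : DPlus A) : theta A (Algebra.GrothendieckAddGroup.of c) = thetaPlus A c :=
    thetaHom_of c
  rw [map_sub, hθ, hθ]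
  simp only [map_sub]
  exact (isBigO_dimAction_pow_thetaPlus h h' hr U).sub (isBigO_dimAction_pow_thetaPlus h h' hr V)

end EdgeShift

theorem theorem4p2_general {k : ℕ} (A : Matrix (Fin k) (Fin k) ℕ) [EdgeShift.IrredPosEntropy A]
    (φ : EdgeShift.ShiftAut A) (hφ : EdgeShift.HasLyapunovMinus φ 0)
    (hφinv : EdgeShift.HasLyapunovMinus φ⁻¹ 0) (μ : ℂ)
    (hμ : Module.End.HasEigenvalue
      (LinearMap.baseChange ℂ (EdgeShift.dimRep A φ).1.toLinearMap) μ) :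
    ‖μ‖ = 1 := by
  have hinv : EdgeShift.dimAction φ⁻¹ = (EdgeShift.dimAction φ)⁻¹ :=
    congrArg Subtype.val (map_inv (EdgeShift.dimRep A) φ)
  refine EdgeShift.norm_eq_one_of_hasEigenvalue_baseChange
    (fun r hr g => EdgeShift.isBigO_dimAction_pow hφ hφinv hr g) (fun r hr g => ?_) hμ
  rw [← hinv]
  exact EdgeShift.isBigO_dimAction_pow hφinv (by rwa [inv_inv]) hr g

theorem theorem4p2 {k : ℕ} (A : Matrix (Fin k) (Fin k) ℕ) [EdgeShift.IrredPosEntropy A]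
    (φ : EdgeShift.ShiftAut A)
    (hφ : EdgeShift.RangeDistorted φ) (hφinv : EdgeShift.RangeDistorted φ⁻¹)
    (μ : ℂ)
    (hμ : Module.End.HasEigenvalue
      (LinearMap.baseChange ℂ (EdgeShift.dimRep A φ).1.toLinearMap) μ) :
    ‖μ‖ = 1 :=
  theorem4p2_general A φ hφ.1 hφinv.1 μ hμ
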